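/- Let $X$ and $Y$ be connected smooth manifolds whose total singular cohomology rings $H^*(X)=\bigoplus_n H^n(X;\mathbb{C})$ and $H^*(Y)=\bigoplus_n H^n(Y;\mathbb{C})$ are finite-dimensional over $\mathbb{C}$, with their canonical vector space topology. Let $H^*(X)\otimes H^*(Y)$ be the tensor product of graded algebras, $(a\otimes b)(a'\otimes b')=(-1)^{\deg b\,\deg a'}aa'\otimes bb'$ (it is $H^*(X\times Y)$ by the Künneth theorem). In any of these rings write $\gamma=\gamma_0+\gamma_{>0}$, where $\gamma_0\in\mathbb{C}$ is the degree zero component and $\gamma_{>0}$ is the (nilpotent) component of positive degree, and put $$t^{\gamma}=t^{\gamma_0}\sum_{k\ge 0}\frac{(\log t)^k}{k!}\,\gamma_{>0}^k\quad(t>0),\qquad \Gamma(\gamma)=\sum_{k\ge 0}\frac{\Gamma^{(k)}(\gamma_0)}{k!}\,\gamma_{>0}^k\quad(\gamma_0\notin\{0,-1,-2,\dots\}).$$ For an integer $r>0$, a real $T>0$ and classes $\beta$, $A$, $\alpha_{rm}$ ($m\ge 0$), the series $\alpha(t)=\sum_{m\ge 0}\alpha_{rm}t^{rm+\beta}$ is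 called $(T,A)$-scaled asymptotically Mittag-Leffler, with period $r$ and exponent $\beta$, if $$\alpha_{rm}=\frac{T^{rm+\beta}}{\Gamma(1+rm+\beta)}\cdot\bigl(A+o(1)\bigr)\qquad\text{as } m\to\infty .$$ Let $\alpha^X:\mathbb{R}_{>0}\to H^*(X)$ and $\alpha^Y:\mathbb{R}_{>0}\to H^*(Y)$ have the convergent expansions $$\alpha^X(t)=\sum_{m\ge 0}\alpha^X_{r_Xm}t^{r_Xm+\beta_X},\qquad \alpha^Y(t)=\sum_{m\ge 0}\alpha^Y_{r_Ym}t^{r_Ym+\beta_Y}\qquad(t>0),$$ where $\beta_X$ and $\beta_Y$ are sums of classes of even degree. Suppose that these series are asymptotically Mittag-Leffler with scalings $(T_X,A_X)$ and $(T_Y,A_Y)$, respectively. Let $r=\gcd(r_X,r_Y)$ and $\beta=\beta_X\otimes 1+1\otimes\beta_Y$. Then for all $t>0$ $$\alpha^X(t)\otimes\alpha^Y(t)=\sum_{m\ge 0}c_{rm}\,t^{rm+\beta},\qquad c_{rm}=\sum_{\substack{i,j\ge 0\\ r_Xi+r_Yj=rm}}\alpha^X_{r_Xi}\otimes\alpha^Y_{r_Yj},$$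 and this series is $\bigl(T_X+T_Y,\ \tfrac{r}{r_Xr_Y}A_X\otimes A_Y\bigr)$-scaled asymptotically Mittag-Leffler, with period $r$ and exponent $\beta$. -/

import Mathlib

open scoped DirectSum TensorProduct Manifold ContDiff

/-! ### Singular cohomology with complex coefficients and its cup product -/

namespace SingCoh

/-- Singular `n`-simplices of `X`. -/
abbrev Simplex (X : Type*) [TopologicalSpace X] (n : ℕ) : Type _ :=
  C(stdSimplex ℝ (Fin (n + 1)), X)

/-- The affine map of standard simplices induced by a map of vertices. -/
noncomputable def affine {m n : ℕ} (θ : Fin (m + 1) → Fin (n + 1)) :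
    C(stdSimplex ℝ (Fin (m + 1)), stdSimplex ℝ (Fin (n + 1))) :=
  ⟨stdSimplex.map θ, stdSimplex.continuous_map θ⟩

/-- The increasing map of vertices that omits the vertex `i`. -/
def skip (n i : ℕ) (k : Fin (n + 1)) : Fin (n + 2) :=
  if (k : ℕ) < i then k.castSucc else k.succ

theorem skip_val (n i : ℕ) (k : Fin (n + 1)) :
    (skip n i k : ℕ) = if (k : ℕ) < i then (k : ℕ) else (k : ℕ) + 1 := by
  unfold skip
  split_ifs <;> simp

/-- The inclusion of the first `p + 1` vertices. -/
def front {p q n : ℕ} (h : p + q = n) (k : Fin (p + 1)) : Fin (n + 1) :=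
  ⟨k, by omega⟩

/-- The inclusion of the last `q + 1` vertices. -/
def back {p q n : ℕ} (h : p + q = n) (k : Fin (q + 1)) : Fin (n + 1) :=
  ⟨p + k, by omega⟩

/-- The simplex `σ` precomposed with an affine map of standard simplices. -/
noncomputable def Simplex.pull {X : Type*} [TopologicalSpace X] {m n : ℕ} (σ : Simplex X n)
    (θ : Fin (m + 1) → Fin (n + 1)) : Simplex X m :=
  σ.comp (affine θ)

/-- Singular `n`-cochains with complex coefficients. -/
abbrev Cochain (X : Type*) [TopologicalSpace X] (n : ℕ) : Type _ := Simplex X n → ℂ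

section

variable {X : Type*} [TopologicalSpace X]

theorem pull_pull {l m n : ℕ} (σ : Simplex X n) (θ : Fin (m + 1) → Fin (n + 1))
    (η : Fin (l + 1) → Fin (m + 1)) : (σ.pull θ).pull η = σ.pull (θ ∘ η) := by
  ext x
  simp [Simplex.pull, affine, stdSimplex.map_comp_apply]

theorem pull_id {n : ℕ} (σ : Simplex X n) (θ : Fin (n + 1) → Fin (n + 1)) (h : ∀ k, θ k = k) :
    σ.pull θ = σ := by
  obtain rfl : θ = id := funext h
  ext x
  simp [Simplex.pull, affine]

/-- The singular coboundary. -/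
noncomputable def d (n : ℕ) : Cochain X n →ₗ[ℂ] Cochain X (n + 1) where
  toFun f σ := ∑ i ∈ Finset.range (n + 2), (-1 : ℂ) ^ i * f (σ.pull (skip n i))
  map_add' f g := by
    ext σ
    simp [mul_add, Finset.sum_add_distrib]
  map_smul' c f := by
    ext σ
    simp only [Pi.smul_apply, smul_eq_mul, RingHom.id_apply, Finset.mul_sum]
    exact Finset.sum_congr rfl fun i _ => by ring

theorem d_apply (n : ℕ) (f : Cochain X n) (σ : Simplex X (n + 1)) :
    d n f σ = ∑ i ∈ Finset.range (n + 2), (-1 : ℂ) ^ i * f (σ.pull (skip n i)) := rfl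

/-- The cup product of cochains: front face times back face. -/
noncomputable def cup {p q n : ℕ} (h : p + q = n) :
    Cochain X p →ₗ[ℂ] Cochain X q →ₗ[ℂ] Cochain X n :=
  LinearMap.mk₂ ℂ (fun f g σ => f (σ.pull (front h)) * g (σ.pull (back h)))
    (fun f f' g => by ext σ; simp [add_mul])
    (fun c f g => by ext σ; simp [mul_assoc])
    (fun f g g' => by ext σ; simp [mul_add])
    (fun c f g => by ext σ; simp [mul_left_comm])

theorem cup_apply {p q n : ℕ} (h : p + q = n) (f : Cochain X p) (g : Cochain X q)
    (σ : Simplex X n) : cup h f g σ = f (σ.pull (front h)) * g (σ.pull (back h)) := rfl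

theorem leibniz {p q n : ℕ} (h : p + q = n) (f : Cochain X p) (g : Cochain X q) :
    d n (cup h f g) = cup (by omega : p + 1 + q = n + 1) (d p f) g
      + (-1 : ℂ) ^ p • cup (by omega : p + (q + 1) = n + 1) f (d q g) := by
  subst h
  ext σ
  simp only [d_apply, cup_apply, Pi.add_apply, Pi.smul_apply, smul_eq_mul, pull_pull]
  have e1 : ∀ i ∈ Finset.range (p + 1),
      (-1 : ℂ) ^ i * (f (σ.pull (skip (p + q) i ∘ front rfl)) *
        g (σ.pull (skip (p + q) i ∘ back rfl)))
      = (-1 : ℂ) ^ i * f (σ.pull (front (by omega : p + 1 + q = p + q + 1) ∘ skip p i)) *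
        g (σ.pull (back (by omega : p + 1 + q = p + q + 1))) := by
    intro i hi
    have hi' : i < p + 1 := Finset.mem_range.1 hi
    have a1 : skip (p + q) i ∘ front (rfl : p + q = p + q)
        = front (by omega : p + 1 + q = p + q + 1) ∘ skip p i := by
      funext k
      ext
      simp only [Function.comp, skip_val, front]
    have a2 : skip (p + q) i ∘ back (rfl : p + q = p + q)
        = back (by omega : p + 1 + q = p + q + 1) := by
      funext k
      ext
      simp only [Function.comp, skip_val, back]
      split_ifs <;> omega
    rw [a1, a2]
    ring
  have e2 : ∀ j ∈ Finset.range (q + 1),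
      (-1 : ℂ) ^ (p + 1 + j) * (f (σ.pull (skip (p + q) (p + 1 + j) ∘ front rfl)) *
        g (σ.pull (skip (p + q) (p + 1 + j) ∘ back rfl)))
      = (-1 : ℂ) ^ p * (f (σ.pull (front (by omega : p + (q + 1) = p + q + 1))) *
        ((-1 : ℂ) ^ (j + 1) *
        g (σ.pull (back (by omega : p + (q + 1) = p + q + 1) ∘ skip q (j + 1))))) := by
    intro j _
    have a1 : skip (p + q) (p + 1 + j) ∘ front (rfl : p + q = p + q)
        = front (by omega : p + (q + 1) = p + q + 1) := by
      funext k
      ext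
      simp only [Function.comp, skip_val, front]
      split_ifs <;> omega
    have a2 : skip (p + q) (p + 1 + j) ∘ back (rfl : p + q = p + q)
        = back (by omega : p + (q + 1) = p + q + 1) ∘ skip q (j + 1) := by
      funext k
      ext
      simp only [Function.comp, skip_val, back]
      split_ifs <;> omega
    rw [a1, a2]
    ring
  have b1 : front (by omega : p + 1 + q = p + q + 1) ∘ skip p (p + 1)
      = front (by omega : p + (q + 1) = p + q + 1) := by
    funext k
    ext
    simp only [Function.comp, skip_val, front]
    split_ifs <;> omega
  have b2 : back (by omega : p + (q + 1) = p + q + 1) ∘ skip q 0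
      = back (by omega : p + 1 + q = p + q + 1) := by
    funext k
    ext
    simp only [Function.comp, skip_val, back]
    split_ifs <;> omega
  rw [show Finset.range (p + q + 2) = Finset.range (p + 1 + (q + 1)) from
      congrArg Finset.range (by ring), Finset.sum_range_add, Finset.sum_congr rfl e1, Finset.sum_congr rfl e2,
    Finset.sum_range_succ _ (p + 1), Finset.sum_range_succ' _ (q + 1), b1, b2,
    ← Finset.sum_mul, ← Finset.mul_sum, ← Finset.mul_sum]
  ring

end

/-- Singular `n`-cocycles. -/
noncomputable def Z (X : Type*) [TopologicalSpace X] (n : ℕ) : Submodule ℂ (Cochain X n) :=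
  LinearMap.ker (d n)

/-- Singular `n`-coboundaries. -/
noncomputable def B (X : Type*) [TopologicalSpace X] : ∀ n : ℕ, Submodule ℂ (Cochain X n)
  | 0 => ⊥
  | n + 1 => LinearMap.range (d n)

/-- The singular cohomology group `H^n(X; ℂ)`, cocycles modulo coboundaries. -/
def H (X : Type*) [TopologicalSpace X] (n : ℕ) : Type _ :=
  (Z X n) ⧸ (B X n).comap (Z X n).subtype

section

variable {X : Type*} [TopologicalSpace X]

noncomputable instance (n : ℕ) : AddCommGroup (H X n) :=
  inferInstanceAs (AddCommGroup ((Z X n) ⧸ (B X n).comap (Z X n).subtype))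

noncomputable instance (n : ℕ) : Module ℂ (H X n) :=
  inferInstanceAs (Module ℂ ((Z X n) ⧸ (B X n).comap (Z X n).subtype))

theorem mem_Z {n : ℕ} {f : Cochain X n} : f ∈ Z X n ↔ d n f = 0 := LinearMap.mem_ker

theorem cup_mem_Z {p q n : ℕ} (h : p + q = n) {f : Cochain X p} {g : Cochain X q}
    (hf : f ∈ Z X p) (hg : g ∈ Z X q) : cup h f g ∈ Z X n := by
  rw [mem_Z] at *
  rw [leibniz, hf, hg]
  simp

theorem cup_mem_B_left {p q n : ℕ} (h : p + q = n) {f : Cochain X p} {g : Cochain X q}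
    (hf : f ∈ B X p) (hg : g ∈ Z X q) : cup h f g ∈ B X n := by
  cases p with
  | zero =>
    obtain rfl : f = 0 := hf
    simp
  | succ p =>
    obtain ⟨e, rfl⟩ := hf
    obtain rfl : n = (p + q) + 1 := by omega
    refine ⟨cup rfl e g, ?_⟩
    rw [mem_Z] at hg
    rw [leibniz, hg]
    simp

theorem cup_mem_B_right {p q n : ℕ} (h : p + q = n) {f : Cochain X p} {g : Cochain X q}
    (hf : f ∈ Z X p) (hg : g ∈ B X q) : cup h f g ∈ B X n := by
  cases q with
  | zero =>
    obtain rfl : g = 0 := hg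
    simp
  | succ q =>
    obtain ⟨e, rfl⟩ := hg
    obtain rfl : n = (p + q) + 1 := by omega
    refine ⟨(-1 : ℂ) ^ p • cup rfl f e, ?_⟩
    rw [mem_Z] at hf
    rw [map_smul, leibniz, hf]
    simp [smul_smul, ← mul_pow]

/-- The class of a cocycle. -/
noncomputable def cls {n : ℕ} : Z X n →ₗ[ℂ] H X n :=
  ((B X n).comap (Z X n).subtype).mkQ

/-- A linear map on cocycles that vanishes on coboundaries, on cohomology. -/
noncomputable def descend {n : ℕ} {M : Type*} [AddCommGroup M] [Module ℂ M] (φ : Z X n →ₗ[ℂ] M)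
    (h : ∀ f : Z X n, f.1 ∈ B X n → φ f = 0) : H X n →ₗ[ℂ] M :=
  ((B X n).comap (Z X n).subtype).liftQ φ fun f hf => h f hf

theorem cls_eq_zero {n : ℕ} {f : Z X n} (h : f.1 ∈ B X n) : cls f = 0 :=
  (Submodule.Quotient.mk_eq_zero _).2 h

theorem descend_cls {n : ℕ} {M : Type*} [AddCommGroup M] [Module ℂ M] (φ : Z X n →ₗ[ℂ] M)
    (h : ∀ f : Z X n, f.1 ∈ B X n → φ f = 0) (f : Z X n) : descend φ h (cls f) = φ f :=
  rfl

theorem cls_surjective {n : ℕ} (a : H X n) : ∃ f : Z X n, cls f = a :=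
  Submodule.Quotient.mk_surjective _ a

/-- The cup product of cocycles, as a cocycle. -/
noncomputable def cupZ (p q : ℕ) : Z X p →ₗ[ℂ] Z X q →ₗ[ℂ] Z X (p + q) :=
  LinearMap.mk₂ ℂ (fun f g => ⟨cup rfl f.1 g.1, cup_mem_Z rfl f.2 g.2⟩)
    (fun f f' g => by ext : 1; simp)
    (fun c f g => by ext : 1; simp)
    (fun f g g' => by ext : 1; simp)
    (fun c f g => by ext : 1; simp)

/-- The cup product in cohomology. -/
noncomputable def cupH (p q : ℕ) : H X p →ₗ[ℂ] H X q →ₗ[ℂ] H X (p + q) :=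
  descend
    (LinearMap.flip (descend (LinearMap.flip ((cupZ p q).compr₂ cls))
      (fun g hg => LinearMap.ext fun f => cls_eq_zero (cup_mem_B_right rfl f.2 hg))))
    (fun f hf => LinearMap.ext fun b => by
      obtain ⟨g, rfl⟩ := cls_surjective b
      exact cls_eq_zero (cup_mem_B_left rfl hf g.2))

theorem cupH_cls {p q : ℕ} (f : Z X p) (g : Z X q) : cupH p q (cls f) (cls g) = cls (cupZ p q f g) :=
  rfl

/-- The constant `0`-cocycle with value `c`. -/
noncomputable def const (X : Type*) [TopologicalSpace X] : ℂ →ₗ[ℂ] Z X 0 where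
  toFun c := ⟨fun _ => c, by rw [mem_Z]; ext σ; simp [d_apply, Finset.sum_range_succ]⟩
  map_add' _ _ := rfl
  map_smul' _ _ := rfl

theorem mk_cls_eq {m n : ℕ} (h : m = n) (f : Z X m) (g : Z X n)
    (hfg : ∀ σ : Simplex X n, f.1 (σ.pull (Fin.cast (by omega))) = g.1 σ) :
    GradedMonoid.mk (A := H X) m (cls f) = GradedMonoid.mk n (cls g) := by
  subst h
  congr 2
  ext σ
  rw [← hfg σ]
  exact congrArg f.1 (pull_id _ _ fun k => rfl).symm

noncomputable instance gMul : GradedMonoid.GMul (H X) where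
  mul {p q} a b := cupH p q a b

noncomputable instance gOne : GradedMonoid.GOne (H X) where
  one := cls (const X 1)

noncomputable instance gMonoid : GradedMonoid.GMonoid (H X) where
  one_mul a := by
    obtain ⟨n, a⟩ := a
    obtain ⟨f, rfl⟩ := cls_surjective a
    refine mk_cls_eq (zero_add n) (cupZ 0 n (const X 1) f) f fun σ => ?_
    refine (one_mul _).trans (congrArg f.1 ?_)
    rw [pull_pull]
    refine pull_id _ _ fun k => ?_
    ext
    simp [back]
  mul_one a := by
    obtain ⟨n, a⟩ := a
    obtain ⟨f, rfl⟩ := cls_surjective a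
    refine mk_cls_eq (add_zero n) (cupZ n 0 f (const X 1)) f fun σ => ?_
    refine (mul_one _).trans (congrArg f.1 ?_)
    rw [pull_pull]
    refine pull_id _ _ fun k => ?_
    ext
    simp [front]
  mul_assoc a b c := by
    obtain ⟨p, a⟩ := a
    obtain ⟨q, b⟩ := b
    obtain ⟨s, c⟩ := c
    obtain ⟨f, rfl⟩ := cls_surjective a
    obtain ⟨g, rfl⟩ := cls_surjective b
    obtain ⟨e, rfl⟩ := cls_surjective c
    refine mk_cls_eq (add_assoc p q s) (cupZ (p + q) s (cupZ p q f g) e)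
      (cupZ p (q + s) f (cupZ q s g e)) fun σ => ?_
    refine (mul_assoc _ _ _).trans ?_
    simp only [cupZ, LinearMap.mk₂_apply, cup_apply, pull_pull]
    have h3 : Fin.cast (by omega : p + (q + s) + 1 = p + q + s + 1).symm ∘
        back (rfl : p + q + s = p + q + s)
        = back (rfl : p + (q + s) = p + (q + s)) ∘ back (rfl : q + s = q + s) := by
      funext k
      ext
      simp [back, add_assoc]
    exact congrArg₂ _ rfl (congrArg₂ _ rfl (congrArg (fun θ => e.1 (σ.pull θ)) h3))

noncomputable instance gRing : DirectSum.GRing (H X) where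
  __ := gMonoid
  mul_zero a := map_zero (cupH _ _ a)
  zero_mul b := LinearMap.map_zero₂ (cupH _ _) b
  mul_add a b c := map_add (cupH _ _ a) b c
  add_mul a b c := LinearMap.map_add₂ (cupH _ _) a b c
  natCast n := cls (const X n)
  natCast_zero := by
    rw [Nat.cast_zero, map_zero]
    rfl
  natCast_succ n := by
    rw [Nat.cast_succ, map_add]
    rfl
  intCast n := cls (const X n)
  intCast_ofNat n := by simp
  intCast_negSucc_ofNat n := by
    rw [Int.cast_negSucc, map_neg]
    rfl

noncomputable instance gAlgebra : DirectSum.GAlgebra ℂ (H X) where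
  toFun := (cls.comp (const X)).toAddMonoidHom
  map_one := rfl
  map_mul r s := by
    refine mk_cls_eq (zero_add 0).symm (const X (r * s)) (cupZ 0 0 (const X r) (const X s))
      fun σ => rfl
  commutes r a := by
    obtain ⟨n, a⟩ := a
    obtain ⟨f, rfl⟩ := cls_surjective a
    refine mk_cls_eq (by omega) (cupZ 0 n (const X r) f) (cupZ n 0 f (const X r)) fun σ => ?_
    refine (mul_comm _ _).trans (congrArg (fun τ => f.1 τ * r) ?_)
    rw [pull_pull]
    congr 1
    funext k
    ext
    simp [front, back]
  smul_def r a := by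
    obtain ⟨n, a⟩ := a
    obtain ⟨f, rfl⟩ := cls_surjective a
    refine mk_cls_eq (by omega) (r • f) (cupZ 0 n (const X r) f) fun σ => ?_
    refine congrArg (fun τ => r * f.1 τ) ?_
    congr 1
    funext k
    ext
    simp [back]

end

end SingCoh

/-- The total singular cohomology ring `H^*(X) = ⨁ n, H^n(X; ℂ)` with the cup product. -/
def Cohomology (X : Type*) [TopologicalSpace X] : Type _ := ⨁ n, SingCoh.H X n

namespace Cohomology

section

variable (X : Type*) [TopologicalSpace X]

noncomputable instance : Ring (Cohomology X) := inferInstanceAs (Ring (⨁ n, SingCoh.H X n))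

noncomputable instance : Algebra ℂ (Cohomology X) :=
  inferInstanceAs (Algebra ℂ (⨁ n, SingCoh.H X n))

/-- The canonical topology of a complex vector space; on a finite-dimensional one it is the
topology of any norm. -/
noncomputable instance : TopologicalSpace (Cohomology X) := moduleTopology ℂ (Cohomology X)

/-- The inclusion of `H^n(X)` into `H^*(X)`. -/
noncomputable def incl (n : ℕ) : SingCoh.H X n →ₗ[ℂ] Cohomology X :=
  DirectSum.lof ℂ ℕ (SingCoh.H X) n

/-- The component in `H^n(X)` of a class. -/
noncomputable def comp (n : ℕ) : Cohomology X →ₗ[ℂ] SingCoh.H X n :=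
  DirectSum.component ℂ ℕ (SingCoh.H X) n

/-- `H^n(X)` as a subspace of `H^*(X)`. -/
noncomputable def deg (n : ℕ) : Submodule ℂ (Cohomology X) := LinearMap.range (incl X n)

theorem incl_mem (n : ℕ) (a : SingCoh.H X n) : incl X n a ∈ deg X n := ⟨a, rfl⟩

noncomputable instance : SetLike.GradedMonoid (deg X) where
  one_mem := ⟨GradedMonoid.GOne.one, rfl⟩
  mul_mem := by
    rintro i j _ _ ⟨a, rfl⟩ ⟨b, rfl⟩
    exact ⟨GradedMonoid.GMul.mul a b, (DirectSum.of_mul_of a b).symm⟩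

/-- The decomposition of a class into its homogeneous components. -/
noncomputable def decomp : Cohomology X →ₗ[ℂ] ⨁ n, deg X n :=
  DirectSum.toModule ℂ ℕ (⨁ n, deg X n) fun n =>
    (DirectSum.lof ℂ ℕ (fun n => deg X n) n).comp (incl X n).rangeRestrict

theorem decomp_incl (n : ℕ) (a : SingCoh.H X n) :
    decomp X (incl X n a) = DirectSum.lof ℂ ℕ (fun n => deg X n) n ⟨incl X n a, incl_mem X n a⟩ :=
  DirectSum.toModule_lof ℂ n a

theorem coe_decomp : DirectSum.coeLinearMap (deg X) ∘ₗ decomp X = .id := by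
  refine DirectSum.linearMap_ext ℂ fun n => LinearMap.ext fun a => ?_
  change DirectSum.coeLinearMap (deg X) (decomp X (incl X n a)) = incl X n a
  rw [decomp_incl, DirectSum.coeLinearMap_lof]

theorem decomp_coe : decomp X ∘ₗ DirectSum.coeLinearMap (deg X) = .id := by
  refine DirectSum.linearMap_ext ℂ fun n => LinearMap.ext fun a => ?_
  obtain ⟨_, b, rfl⟩ := a
  change decomp X (DirectSum.coeLinearMap (deg X) (DirectSum.lof ℂ ℕ (fun n => deg X n) n _)) = _
  rw [DirectSum.coeLinearMap_lof, decomp_incl]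
  rfl

noncomputable instance : GradedAlgebra (deg X) where
  __ := DirectSum.Decomposition.ofLinearMap (deg X) (decomp X) (coe_decomp X) (decomp_coe X)

/-- Evaluation at a point `x` of the `H^0`-component, a locally constant function. -/
noncomputable def evalAt {X : Type*} [TopologicalSpace X] (x : X) : Cohomology X →ₗ[ℂ] ℂ :=
  (SingCoh.descend
    ((LinearMap.proj (ContinuousMap.const _ x)).comp (SingCoh.Z X 0).subtype)
    (fun f hf => congrFun (show f.1 = 0 from hf) _)).comp (comp X 0)

/-- The `H^0`-component of a class on a connected space, as a complex number. -/
noncomputable def scalar [ConnectedSpace X] : Cohomology X →ₗ[ℂ] ℂ :=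
  evalAt (Classical.arbitrary X)

/-- The class lies in `⨁ k, H^{2k}(X)`. -/
def IsEven {X : Type*} [TopologicalSpace X] (a : Cohomology X) : Prop :=
  ∀ n, Odd n → comp X n a = 0

end

end Cohomology

/-- The ring `H^*(X) ⊗ H^*(Y)`, the tensor product of graded algebras, with
`(a ⊗ b) (a' ⊗ b') = (-1) ^ (deg b * deg a') (a a') ⊗ (b b')`. -/
abbrev CohomologyTensor (X Y : Type*) [TopologicalSpace X] [TopologicalSpace Y] : Type _ :=
  GradedTensorProduct ℂ (Cohomology.deg X) (Cohomology.deg Y)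

namespace CohomologyTensor

section

variable (X Y : Type*) [TopologicalSpace X] [TopologicalSpace Y]

/-- The canonical topology of a complex vector space, as for `H^*(X)`. -/
noncomputable instance : TopologicalSpace (CohomologyTensor X Y) :=
  moduleTopology ℂ (CohomologyTensor X Y)

/-- The tensor `a ⊗ b`. -/
noncomputable def tmul {X Y : Type*} [TopologicalSpace X] [TopologicalSpace Y]
    (a : Cohomology X) (b : Cohomology Y) : CohomologyTensor X Y :=
  GradedTensorProduct.tmul ℂ a b

/-- The component in `H^0(X) ⊗ H^0(Y)`, as a complex number, for connected `X` and `Y`. -/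
noncomputable def scalar [ConnectedSpace X] [ConnectedSpace Y] :
    CohomologyTensor X Y →ₗ[ℂ] ℂ :=
  (LinearMap.mul' ℂ ℂ).comp
    ((TensorProduct.map (Cohomology.scalar X) (Cohomology.scalar Y)).comp
      (GradedTensorProduct.of ℂ (Cohomology.deg X) (Cohomology.deg Y)).symm.toLinearMap)

end

end CohomologyTensor

/-! ### Asymptotically Mittag-Leffler series

Below `A` is one of the rings `H^*(X)`, `H^*(X) ⊗ H^*(Y)`, and `ε` takes the (complex number
giving the) degree zero component `γ₀` of a class `γ`, so that `γ - ε γ` is the component of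
positive degree, which is nilpotent when `A` is finite-dimensional. -/

namespace AML

section

variable {A : Type*} [Ring A] [Algebra ℂ A]

/-- The positive degree component `γ - γ₀`. -/
noncomputable def pos (ε : A →ₗ[ℂ] ℂ) (γ : A) : A := γ - algebraMap ℂ A (ε γ)

/-- `Γ(γ) = ∑ k, Γ^{(k)}(γ₀) / k! * (γ - γ₀) ^ k`, a finite sum. -/
noncomputable def gamma (ε : A →ₗ[ℂ] ℂ) (γ : A) : A :=
  ∑ᶠ k : ℕ, (iteratedDeriv k Complex.Gamma (ε γ) / (k.factorial : ℂ)) • pos ε γ ^ k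

/-- `t ^ γ = t ^ γ₀ * ∑ k, (log t) ^ k / k! * (γ - γ₀) ^ k` for `t > 0`, a finite sum. -/
noncomputable def power (ε : A →ₗ[ℂ] ℂ) (t : ℝ) (γ : A) : A :=
  ((t : ℂ) ^ ε γ) •
    ∑ᶠ k : ℕ, (((Real.log t : ℝ) : ℂ) ^ k / (k.factorial : ℂ)) • pos ε γ ^ k

variable [TopologicalSpace A]

/-- `f t = ∑ m, c m * t ^ (r m + β)` for all `t > 0`. -/
def HasExpansion (ε : A →ₗ[ℂ] ℂ) (r : ℕ) (β : A) (c : ℕ → A) (f : ℝ → A) : Prop :=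
  ∀ t : ℝ, 0 < t → HasSum (fun m : ℕ => c m * power ε t (((r * m : ℕ) : A) + β)) (f t)

/-- The series `∑ m, c m * t ^ (r m + β)` is `(T, S)`-scaled asymptotically Mittag-Leffler:
`c m = T ^ (r m + β) / Γ (1 + r m + β) * (S + o(1))` as `m → ∞`. -/
def IsAML (ε : A →ₗ[ℂ] ℂ) (r : ℕ) (β : A) (c : ℕ → A) (T : ℝ) (S : A) : Prop :=
  0 < r ∧ 0 < T ∧ ∃ R : ℕ → A, Filter.Tendsto R Filter.atTop (nhds 0) ∧
    ∀ᶠ m : ℕ in Filter.atTop,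
      c m = power ε T (((r * m : ℕ) : A) + β) *
        Ring.inverse (gamma ε (1 + ((r * m : ℕ) : A) + β)) * (S + R m)

end

/-- The coefficients of the product of two series: at index `m`, the sum of
`a i ⊗ b j` over all `i`, `j` with `p i + q j = gcd(p, q) m`. -/
noncomputable def prodCoeff {X Y : Type*} [TopologicalSpace X] [TopologicalSpace Y] (p q : ℕ)
    (a : ℕ → Cohomology X) (b : ℕ → Cohomology Y) (m : ℕ) : CohomologyTensor X Y :=
  ∑ ij ∈ (Finset.range (Nat.gcd p q * m + 1) ×ˢ Finset.range (Nat.gcd p q * m + 1)).filter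
      (fun ij => p * ij.1 + q * ij.2 = Nat.gcd p q * m),
    CohomologyTensor.tmul (a ij.1) (b ij.2)

end AML

/-!
Everything takes place in finite-dimensional algebras, and the exponents enter only through their
scalar part and their nilpotent part: a connected manifold is path-connected, so `H^0` consists of
scalars, and a class without component of degree zero is nilpotent because the degrees are bounded.

Put `n = r m`. The Taylor coefficients at `β` of `Γ(1 + n + z) / (n! n ^ z)` tend to those of the
constant `1` (`AML.tendsto_iteratedDeriv_gammaRatio`: Euler's limit formula, log-convexity of `Γ`
and Cauchy's formula). Hence `Γ(1 + n + β) = n! n ^ β (1 + o(1))`, and a series is `(T, A)`-scaled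
asymptotically Mittag-Leffler exactly when its normalized coefficients `n! T ^ (-n) (n / T) ^ β c_n`
converge to `A` (`AML.isAML_iff`).

Put `T = T_X + T_Y`, `p = T_X / T`, `q = T_Y / T`. As the components of `β_X` and `β_Y` have even
degree, no signs occur when their powers are moved through a tensor product, and the normalized
coefficient of `α_X ⊗ α_Y` at index `N` is the sum of `binom(N, n) p ^ n q ^ (N - n) V(N, n)` over
those `n ≤ N` with `r_X ∣ n` and `r_Y ∣ N - n` (`AML.normalize_tmul`). Here `V(N, n)` is the tensor
product of the normalized coefficients of the two factors, corrected by
`(p N / n) ^ β_X ⊗ (q N / (N - n)) ^ β_Y`. It grows at most polynomially in `N`, and it converges to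
`A_X ⊗ A_Y` when `n / N → p`. By Chernoff's bound the binomial distribution is concentrated at
`n / N ≈ p` up to an exponentially small mass, so the polynomial growth is harmless and the sum
differs by `o(1)` from `A_X ⊗ A_Y` times the binomial mass of the lattice of admissible `n`
(`AML.tendsto_sum_binomWeight_smul`). By a computation with roots of unity this mass tends to
`r / (r_X r_Y)` along the multiples `N` of `r` (`AML.tendsto_sum_binomWeight_lattice`).

The expansion of the product itself is a rearrangement of an absolutely convergent double series.
The analysis uses a submultiplicative norm on each algebra, induced by a faithful representation;
in finite dimension it induces the canonical topology (`AML.eq_topology_induced`).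
-/

open Filter Topology

/-! ### Asymptotics of the Gamma function on vertical strips -/

theorem Complex.norm_Gamma_le_Gamma_re {s : ℂ} (hs : 0 < s.re) :
    ‖Complex.Gamma s‖ ≤ Real.Gamma s.re := by
  rw [Complex.Gamma_eq_integral hs, Real.Gamma_eq_integral hs, Complex.GammaIntegral]
  refine (MeasureTheory.norm_integral_le_integral_norm _).trans (le_of_eq ?_)
  refine MeasureTheory.setIntegral_congr_fun measurableSet_Ioi fun x hx => ?_
  have hx : 0 < x := hx
  simp only [norm_mul, Complex.norm_cpow_eq_rpow_re_of_pos hx, Complex.sub_re, Complex.one_re]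
  rw [Complex.norm_real, Real.norm_of_nonneg (Real.exp_pos _).le]

namespace AML

/-- The ratio `Γ(1 + n + z) / (n! n ^ z)`, which tends to `1` as `n → ∞`. -/
noncomputable def gammaRatio (n : ℕ) (z : ℂ) : ℂ :=
  Complex.Gamma (1 + n + z) / (n.factorial * (n : ℂ) ^ z)

/-- Log-convexity of `Γ` interpolates between the factorials `(n - K)!` and `(n + K)!`, each of
which is compared with `n! n ^ (∓ K)`. -/
theorem real_Gamma_le {K n : ℕ} (hn : 2 * K < n) {x : ℝ} (hx : |x| < K) :
    Real.Gamma (1 + n + x) ≤ 2 ^ K * (n.factorial * (n : ℝ) ^ x) := by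
  obtain ⟨hx1, hx2⟩ := abs_lt.1 hx
  have hK : (0 : ℝ) < K := lt_of_le_of_lt (abs_nonneg _) hx
  have hn0 : (0 : ℝ) < n := by exact_mod_cast (by omega : 0 < n)
  set a : ℝ := (K - x) / (2 * K) with ha
  set b : ℝ := (K + x) / (2 * K) with hb
  have hab : a + b = 1 := by rw [ha, hb]; field_simp; ring
  have ha0 : 0 < a := div_pos (by linarith) (by linarith)
  have hb0 : 0 < b := div_pos (by linarith) (by linarith)
  have hs : (0 : ℝ) < ((n - K : ℕ) : ℝ) + 1 := by positivity
  have ht : (0 : ℝ) < ((n + K : ℕ) : ℝ) + 1 := by positivity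
  have key := Real.Gamma_mul_add_mul_le_rpow_Gamma_mul_rpow_Gamma hs ht ha0 hb0 hab
  have e : a * (((n - K : ℕ) : ℝ) + 1) + b * (((n + K : ℕ) : ℝ) + 1) = 1 + n + x := by
    rw [Nat.cast_sub (by omega), Nat.cast_add, ha, hb]
    field_simp
    ring
  rw [e, Real.Gamma_nat_eq_factorial, Real.Gamma_nat_eq_factorial] at key
  have h1 : ((n - K).factorial : ℝ) ≤ 2 ^ K * n.factorial * (n : ℝ) ^ (-(K : ℝ)) := by
    rw [Real.rpow_neg hn0.le, Real.rpow_natCast, ← div_eq_mul_inv, le_div_iff₀ (by positivity)]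
    have h := Nat.factorial_mul_pow_le_factorial (n := K) (m := n - K)
    rw [Nat.sub_add_cancel (by omega)] at h
    have h2 : n ^ K ≤ 2 ^ K * (n - K + 1) ^ K := by
      rw [← mul_pow]; exact Nat.pow_le_pow_left (by omega) _
    calc ((n - K).factorial : ℝ) * n ^ K ≤ (n - K).factorial * (2 ^ K * (n - K + 1 : ℕ) ^ K) := by
          gcongr; exact_mod_cast h2
      _ = 2 ^ K * ((n - K).factorial * (n - K + 1 : ℕ) ^ K) := by ring
      _ ≤ 2 ^ K * n.factorial := by gcongr; exact_mod_cast h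
  have h2 : ((n + K).factorial : ℝ) ≤ 2 ^ K * n.factorial * (n : ℝ) ^ (K : ℝ) := by
    rw [Real.rpow_natCast]
    have h : (n + K).factorial ≤ n.factorial * (n + K) ^ K := by
      rw [← Nat.factorial_mul_ascFactorial]
      exact Nat.mul_le_mul_left _ (Nat.ascFactorial_le_pow_add _ _)
    have h3 : (n + K) ^ K ≤ 2 ^ K * n ^ K := by
      rw [← mul_pow]; exact Nat.pow_le_pow_left (by omega) _
    calc ((n + K).factorial : ℝ) ≤ n.factorial * (n + K : ℕ) ^ K := by exact_mod_cast h
      _ ≤ n.factorial * (2 ^ K * n ^ K) := by gcongr; exact_mod_cast h3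
      _ = _ := by ring
  have hc : (0 : ℝ) < 2 ^ K * n.factorial := by positivity
  calc Real.Gamma (1 + n + x) ≤ _ := key
    _ ≤ (2 ^ K * n.factorial * (n : ℝ) ^ (-(K : ℝ))) ^ a *
        (2 ^ K * n.factorial * (n : ℝ) ^ (K : ℝ)) ^ b := by gcongr
    _ = ((2 ^ K * n.factorial : ℝ) ^ a * (2 ^ K * n.factorial : ℝ) ^ b) *
        ((n : ℝ) ^ (-(K : ℝ) * a) * (n : ℝ) ^ ((K : ℝ) * b)) := by
        rw [Real.mul_rpow hc.le (by positivity), Real.mul_rpow hc.le (by positivity),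
          ← Real.rpow_mul hn0.le, ← Real.rpow_mul hn0.le]
        ring
    _ = 2 ^ K * (n.factorial * (n : ℝ) ^ x) := by
        rw [← Real.rpow_add hc, ← Real.rpow_add hn0, hab, Real.rpow_one, mul_assoc]
        congr 3
        rw [ha, hb]
        field_simp
        ring

theorem norm_gammaRatio_le {K n : ℕ} (hn : 2 * K < n) {z : ℂ} (hz : |z.re| < K) :
    ‖gammaRatio n z‖ ≤ 2 ^ K := by
  have hn0 : (0 : ℝ) < n := by exact_mod_cast (by omega : 0 < n)
  have hre : (1 + n + z : ℂ).re = 1 + n + z.re := by simp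
  have hpos : 0 < (1 + n + z : ℂ).re := by
    have h1 : (2 * K : ℝ) < n := by exact_mod_cast hn
    have := (abs_lt.1 hz).1
    rw [hre]
    linarith [(abs_nonneg _).trans_lt hz]
  rw [gammaRatio, norm_div, norm_mul, Complex.norm_natCast,
    Complex.norm_natCast_cpow_of_pos (by omega), div_le_iff₀ (by positivity)]
  refine (Complex.norm_Gamma_le_Gamma_re hpos).trans ?_
  rw [hre]
  exact real_Gamma_le hn hz

theorem differentiableAt_gammaRatio {K n : ℕ} (hn : K < n) {z : ℂ} (hz : |z.re| < K) :
    DifferentiableAt ℂ (gammaRatio n) z := by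
  have hn0 : (n : ℂ) ≠ 0 := by exact_mod_cast (by omega : n ≠ 0)
  have h1 : (K : ℝ) < n := by exact_mod_cast hn
  have h2 := (abs_lt.1 hz).1
  refine DifferentiableAt.div ?_ ?_ ?_
  · refine DifferentiableAt.comp z (Complex.differentiableAt_Gamma _ fun m h => ?_) (by fun_prop)
    have := congrArg Complex.re h
    simp only [Complex.add_re, Complex.one_re, Complex.natCast_re, Complex.neg_re] at this
    have : (0 : ℝ) ≤ m := by positivity
    linarith
  · exact (DifferentiableAt.const_cpow differentiableAt_id (Or.inl hn0)).const_mul _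
  · exact mul_ne_zero (by exact_mod_cast n.factorial_ne_zero) ((Complex.cpow_ne_zero_iff).2
      (Or.inl hn0))

/-- Pointwise convergence away from the poles is Euler's limit formula for `Γ`. -/
theorem tendsto_gammaRatio_of_ne_neg {z : ℂ} (hz : ∀ m : ℕ, z ≠ -m) :
    Tendsto (fun n => gammaRatio n z) atTop (𝓝 1) := by
  have hG : Complex.Gamma z ≠ 0 := Complex.Gamma_ne_zero hz
  have h := (tendsto_const_nhds (x := Complex.Gamma z)).div
    (Complex.GammaSeq_tendsto_Gamma z) hG
  rw [div_self hG] at h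
  refine h.congr' ?_
  filter_upwards [eventually_gt_atTop 0] with n hn
  have e : ∀ n : ℕ, Complex.Gamma (1 + n + z) =
      Complex.Gamma z * ∏ j ∈ Finset.range (n + 1), (z + j) := by
    intro n
    induction n with
    | zero =>
      simp only [Nat.cast_zero, add_zero, zero_add, Finset.prod_range_one]
      rw [add_comm, Complex.Gamma_add_one _ (by simpa using hz 0), mul_comm]
    | succ n ih =>
      rw [Finset.prod_range_succ, ← mul_assoc, ← ih,
        show (1 + ((n + 1 : ℕ) : ℂ) + z) = (1 + n + z) + 1 by push_cast; ring,
        Complex.Gamma_add_one _ fun h => hz (n + 1) (by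
          push_cast; linear_combination h)]
      push_cast
      ring
  have hn0 : (n : ℂ) ≠ 0 := by exact_mod_cast hn.ne'
  have hp : ∏ j ∈ Finset.range (n + 1), (z + j) ≠ 0 :=
    Finset.prod_ne_zero_iff.2 fun j _ h => hz j (eq_neg_of_add_eq_zero_left h)
  rw [gammaRatio, Pi.div_apply, Complex.GammaSeq, e n, div_div_eq_mul_div]
  rw [mul_comm ((n : ℂ) ^ z)]

/-- The Taylor coefficients of `Γ(1 + n + z) / (n! n ^ z)` tend to those of the constant `1`:
pointwise convergence and local boundedness allow passing to the limit in Cauchy's formula. -/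
theorem tendsto_iteratedDeriv_gammaRatio (x : ℂ) (k : ℕ) :
    Tendsto (fun n => iteratedDeriv k (gammaRatio n) x) atTop (𝓝 (if k = 0 then 1 else 0)) := by
  obtain ⟨K, hK⟩ := exists_nat_gt (|x.re| + 1)
  have hball : ∀ z ∈ Metric.closedBall x (1 : ℝ), |z.re| < K := by
    intro z hz
    have h1 : |(z - x).re| ≤ 1 := (Complex.abs_re_le_norm _).trans (by
      simpa [dist_eq_norm] using hz)
    have h2 : |z.re| ≤ |x.re| + |(z - x).re| := by
      have := abs_add_le x.re (z - x).re
      simpa using this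
    linarith
  have formula : ∀ f : ℂ → ℂ, DifferentiableOn ℂ f (Metric.closedBall x 1) →
      iteratedDeriv k f x = (2 * Real.pi * Complex.I / k.factorial)⁻¹ *
        ∮ z in C(x, 1), (1 / (z - x) ^ (k + 1)) • f z := by
    intro f hf
    rw [hf.circleIntegral_one_div_sub_center_pow_smul one_pos k, smul_eq_mul,
      inv_mul_cancel_left₀]
    exact div_ne_zero Complex.two_pi_I_ne_zero (by exact_mod_cast k.factorial_ne_zero)
  have hconst : (if k = 0 then (1 : ℂ) else 0) = iteratedDeriv k (fun _ => (1 : ℂ)) x := by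
    rw [iteratedDeriv_const]
  have hsph : ∀ θ : ℝ, circleMap x 1 θ ∈ Metric.closedBall x (1 : ℝ) := fun θ =>
    circleMap_mem_closedBall x zero_le_one θ
  have hne : ∀ θ : ℝ, circleMap x 1 θ - x ≠ 0 := fun θ =>
    sub_ne_zero.2 (circleMap_ne_center one_ne_zero)
  have hnorm : ∀ θ : ℝ, ‖circleMap x 1 θ - x‖ = 1 := fun θ => by simp
  rw [hconst, formula _ (differentiableOn_const 1)]
  have hev : ∀ᶠ n : ℕ in atTop, (2 * Real.pi * Complex.I / k.factorial)⁻¹ *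
        (∮ z in C(x, 1), (1 / (z - x) ^ (k + 1)) • gammaRatio n z) =
        iteratedDeriv k (gammaRatio n) x := by
    filter_upwards [eventually_gt_atTop K] with n hn
    exact (formula _ fun z hz =>
      (differentiableAt_gammaRatio hn (hball z hz)).differentiableWithinAt).symm
  refine Tendsto.congr' hev (Tendsto.const_mul _ ?_)
  simp only [circleIntegral]
  refine intervalIntegral.tendsto_integral_filter_of_dominated_convergence
    (fun _ => (2 : ℝ) ^ K) ?_ ?_ (by simp) ?_
  · filter_upwards [eventually_gt_atTop K] with n hn
    refine Continuous.aestronglyMeasurable ?_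
    have hc : Continuous fun θ => gammaRatio n (circleMap x 1 θ) :=
      continuous_iff_continuousAt.2 fun θ => ContinuousAt.comp
        (differentiableAt_gammaRatio hn (hball _ (hsph θ))).continuousAt
        (continuous_circleMap x 1).continuousAt
    have hd : Continuous fun θ => (1 : ℂ) / (circleMap x 1 θ - x) ^ (k + 1) :=
      continuous_const.div (((continuous_circleMap x 1).sub continuous_const).pow _)
        fun θ => pow_ne_zero _ (hne θ)
    have hd' : Continuous fun θ => deriv (circleMap x 1) θ := by
      simp only [deriv_circleMap]
      exact (continuous_circleMap 0 1).mul continuous_const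
    exact hd'.smul (hd.smul hc)
  · filter_upwards [eventually_gt_atTop (2 * K)] with n hn
    refine Eventually.of_forall fun θ _ => ?_
    rw [norm_smul, norm_smul, norm_div, norm_pow, hnorm]
    simpa using norm_gammaRatio_le hn (hball _ (hsph θ))
  · -- off the countable set of angles at which the circle meets a pole of `Γ`
    have hcount : (circleMap x 1 ⁻¹' Set.range fun m : ℕ => -(m : ℂ)).Countable :=
      (Set.countable_range _).preimage_circleMap x one_ne_zero
    filter_upwards [hcount.ae_notMem MeasureTheory.volume] with θ hθ _
    refine Tendsto.const_smul (Tendsto.const_smul (tendsto_gammaRatio_of_ne_neg fun m hm => ?_) _) _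
    exact hθ ⟨m, hm.symm⟩

end AML

/-! ### Binomial averages -/

theorem Complex.sum_nthRootsFinset_pow {n : ℕ} (hn : 0 < n) (k : ℕ) :
    ∑ ζ ∈ Polynomial.nthRootsFinset n (1 : ℂ), ζ ^ k = if n ∣ k then (n : ℂ) else 0 := by
  have hprim := Complex.isPrimitiveRoot_exp n hn.ne'
  set ξ := Complex.exp (2 * Real.pi * Complex.I / n)
  split_ifs with h
  · obtain ⟨j, rfl⟩ := h
    rw [Finset.sum_congr rfl (g := fun _ => (1 : ℂ))]
    · simp [hprim.card_nthRootsFinset]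
    · intro ζ hζ
      rw [pow_mul, (Polynomial.mem_nthRootsFinset hn _).1 hζ, one_pow]
  · -- multiplication by a primitive root permutes the roots and scales the sum by `ξ ^ k ≠ 1`
    have hξ : ξ ^ k ≠ 1 := fun h' => h ((hprim.pow_eq_one_iff_dvd k).1 h')
    have hperm : ∑ ζ ∈ Polynomial.nthRootsFinset n (1 : ℂ), ζ ^ k =
        ξ ^ k * ∑ ζ ∈ Polynomial.nthRootsFinset n (1 : ℂ), ζ ^ k := by
      rw [Finset.mul_sum]
      refine (Finset.sum_bij' (fun ζ _ => ξ * ζ) (fun ζ _ => ξ⁻¹ * ζ) ?_ ?_ ?_ ?_ ?_).symm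
      · intro ζ hζ
        rw [Polynomial.mem_nthRootsFinset hn] at hζ ⊢
        rw [mul_pow, hζ, hprim.pow_eq_one, one_mul]
      · intro ζ hζ
        rw [Polynomial.mem_nthRootsFinset hn] at hζ ⊢
        rw [mul_pow, hζ, inv_pow, hprim.pow_eq_one, inv_one, one_mul]
      · intro ζ _
        exact inv_mul_cancel_left₀ (Complex.exp_ne_zero _) _
      · intro ζ _
        exact mul_inv_cancel_left₀ (Complex.exp_ne_zero _) _
      · intro ζ _
        rw [mul_pow]
    by_contra hne
    exact hξ (mul_right_cancel₀ hne (by rw [← hperm, one_mul]))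

namespace AML

/-- The binomial weight: the probability of `n` successes in `N` trials. -/
noncomputable def binomWeight (p q : ℝ) (N n : ℕ) : ℝ := N.choose n * p ^ n * q ^ (N - n)

theorem binomWeight_nonneg {p q : ℝ} (hp : 0 ≤ p) (hq : 0 ≤ q) (N n : ℕ) :
    0 ≤ binomWeight p q N n := by
  unfold binomWeight; positivity

theorem sum_binomWeight {p q : ℝ} (hpq : p + q = 1) (N : ℕ) :
    ∑ n ∈ Finset.range (N + 1), binomWeight p q N n = 1 := by
  have h := add_pow p q N
  rw [hpq, one_pow] at h
  rw [h]
  exact Finset.sum_congr rfl fun n _ => by unfold binomWeight; ring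

theorem norm_combo_lt_one {p q : ℝ} (hp : 0 < p) (hq : 0 < q) (hpq : p + q = 1) {ζ η : ℂ}
    (hζ : ‖ζ‖ = 1) (hη : ‖η‖ = 1) (hne : ζ ≠ η) : ‖(p : ℂ) * ζ + q * η‖ < 1 := by
  have h := norm_combo_lt_of_ne hζ.le hη.le hne hp hq hpq
  simpa [Complex.real_smul] using h

/-- The binomial mass of the lattice `a ∣ n`, `b ∣ N - n`, for `N` a multiple of `gcd a b`, tends to
`gcd a b / (a b)`. The indicator of divisibility is an average over roots of unity, which turns
the mass into the average of `(p ζ + q η) ^ N` over `ζ ^ a = 1`, `η ^ b = 1`; only the `gcd a b`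
diagonal terms `ζ = η` survive in the limit. -/
theorem tendsto_sum_binomWeight_lattice {p q : ℝ} (hp : 0 < p) (hq : 0 < q) (hpq : p + q = 1)
    {a b : ℕ} (ha : 0 < a) (hb : 0 < b) :
    Tendsto (fun m : ℕ => ∑ n ∈ (Finset.range (a.gcd b * m + 1)).filter
        (fun n => a ∣ n ∧ b ∣ a.gcd b * m - n), (binomWeight p q (a.gcd b * m) n : ℂ))
      atTop (𝓝 ((a.gcd b : ℂ) / (a * b))) := by
  classical
  have hg : 0 < a.gcd b := Nat.gcd_pos_of_pos_left _ ha
  have ha0 : (a : ℂ) ≠ 0 := by exact_mod_cast ha.ne'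
  have hb0 : (b : ℂ) ≠ 0 := by exact_mod_cast hb.ne'
  set RA := Polynomial.nthRootsFinset a (1 : ℂ)
  set RB := Polynomial.nthRootsFinset b (1 : ℂ)
  have key : ∀ N : ℕ, ∑ n ∈ (Finset.range (N + 1)).filter (fun n => a ∣ n ∧ b ∣ N - n),
      (binomWeight p q N n : ℂ) =
      (a * b : ℂ)⁻¹ * ∑ ζ ∈ RA, ∑ η ∈ RB, ((p : ℂ) * ζ + q * η) ^ N := by
    intro N
    have e1 : ∀ ζ η : ℂ, ((p : ℂ) * ζ + q * η) ^ N =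
        ∑ n ∈ Finset.range (N + 1), (binomWeight p q N n : ℂ) * (ζ ^ n * η ^ (N - n)) := by
      intro ζ η
      rw [add_pow]
      refine Finset.sum_congr rfl fun n _ => ?_
      simp only [binomWeight]
      push_cast
      ring
    have e2 : ∑ ζ ∈ RA, ∑ η ∈ RB, ((p : ℂ) * ζ + q * η) ^ N =
        ∑ n ∈ Finset.range (N + 1), (binomWeight p q N n : ℂ) *
          ((∑ ζ ∈ RA, ζ ^ n) * ∑ η ∈ RB, η ^ (N - n)) := by
      simp only [e1]
      rw [Finset.sum_congr rfl fun ζ _ => Finset.sum_comm, Finset.sum_comm]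
      refine Finset.sum_congr rfl fun n _ => ?_
      rw [Finset.sum_mul_sum, Finset.mul_sum]
      exact Finset.sum_congr rfl fun ζ _ => (Finset.mul_sum _ _ _).symm
    rw [e2, Finset.mul_sum, Finset.sum_filter]
    refine Finset.sum_congr rfl fun n _ => ?_
    rw [Complex.sum_nthRootsFinset_pow ha, Complex.sum_nthRootsFinset_pow hb]
    by_cases h1 : a ∣ n <;> by_cases h2 : b ∣ N - n <;> simp [h1, h2]
    field_simp
  simp only [key]
  have hmemA : ∀ {ζ : ℂ}, ζ ∈ RA ↔ ζ ^ a = 1 := Polynomial.mem_nthRootsFinset ha _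
  have hmemB : ∀ {ζ : ℂ}, ζ ∈ RB ↔ ζ ^ b = 1 := Polynomial.mem_nthRootsFinset hb _
  have hlim : ∀ ζ ∈ RA, ∀ η ∈ RB, Tendsto (fun m : ℕ => ((p : ℂ) * ζ + q * η) ^ (a.gcd b * m))
      atTop (𝓝 (if ζ = η then 1 else 0)) := by
    intro ζ hζ η hη
    split_ifs with h
    · subst h
      have h1 : ζ ^ a.gcd b = 1 := by
        rw [← orderOf_dvd_iff_pow_eq_one]
        exact Nat.dvd_gcd (orderOf_dvd_of_pow_eq_one (hmemA.1 hζ))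
          (orderOf_dvd_of_pow_eq_one (hmemB.1 hη))
      have h2 : (p : ℂ) * ζ + q * ζ = ζ := by
        rw [← add_mul, ← Complex.ofReal_add, hpq, Complex.ofReal_one, one_mul]
      simp [h2, pow_mul, h1]
    · have hlt := norm_combo_lt_one hp hq hpq
        (Complex.norm_eq_one_of_pow_eq_one (hmemA.1 hζ) ha.ne')
        (Complex.norm_eq_one_of_pow_eq_one (hmemB.1 hη) hb.ne') h
      exact (tendsto_pow_atTop_nhds_zero_of_norm_lt_one hlt).comp
        (tendsto_id.const_mul_atTop' hg)
  have hcount : ∑ ζ ∈ RA, ∑ η ∈ RB, (if ζ = η then (1 : ℂ) else 0) = a.gcd b := by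
    simp only [Finset.sum_ite_eq]
    rw [← Finset.sum_filter]
    have : RA.filter (fun ζ => ζ ∈ RB) = Polynomial.nthRootsFinset (a.gcd b) (1 : ℂ) := by
      ext ζ
      rw [Finset.mem_filter, hmemA, hmemB, Polynomial.mem_nthRootsFinset hg,
        ← orderOf_dvd_iff_pow_eq_one, ← orderOf_dvd_iff_pow_eq_one, ← orderOf_dvd_iff_pow_eq_one,
        Nat.dvd_gcd_iff]
    rw [this, Finset.sum_const, (Complex.isPrimitiveRoot_exp _ hg.ne').card_nthRootsFinset]
    simp
  have hsum := tendsto_finsetSum RA fun ζ hζ => tendsto_finsetSum RB fun η hη => hlim ζ hζ η hη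
  rw [hcount] at hsum
  rw [div_eq_inv_mul]
  exact hsum.const_mul _

/-- Chernoff's bound. For `c ≠ p` the binomial mass of the half line `n ≥ c N` or `n ≤ c N` that
does not contain the mean `p N` is exponentially small; the sign of `s` selects the half line. -/
theorem exists_sum_binomWeight_le_pow {p q : ℝ} (hp : 0 < p) (hq : 0 < q) (hpq : p + q = 1) {c : ℝ}
    (hc : c ≠ p) : ∃ s ρ : ℝ, 0 < s * (c - p) ∧ 0 ≤ ρ ∧ ρ < 1 ∧ ∀ N : ℕ,
      ∑ n ∈ (Finset.range (N + 1)).filter (fun n : ℕ => 0 ≤ s * (n - c * N)), binomWeight p q N n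
        ≤ ρ ^ N := by
  -- the moment generating function of one centred trial, along the ray `s = (c - p) u`
  set f : ℝ → ℝ := fun u =>
    (q + p * Real.exp ((c - p) * u)) * Real.exp (-(c * ((c - p) * u))) with hf
  have hd : HasDerivAt f (-(c - p) ^ 2) 0 := by
    have h1 : HasDerivAt (fun u : ℝ => (c - p) * u) (c - p) 0 := by
      simpa using (hasDerivAt_id (0 : ℝ)).const_mul (c - p)
    have h2 := ((h1.exp.const_mul p).const_add q).mul ((h1.const_mul c).neg.exp)
    refine h2.congr_deriv ?_
    simp only [mul_zero, Real.exp_zero, neg_zero, Pi.neg_apply]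
    linear_combination (-c * (c - p)) * hpq
  have hf0 : f 0 = 1 := by simp [hf]; linarith
  -- `f` starts at `1` with negative slope, so it is below `1` at some `u > 0`
  have hneg : -(c - p) ^ 2 < 0 := by
    have : 0 < (c - p) ^ 2 := by
      have := sub_ne_zero.2 hc
      positivity
    linarith
  have hev : ∀ᶠ u in 𝓝[>] (0 : ℝ), u⁻¹ • (f (0 + u) - f 0) < 0 :=
    ((hasDerivAt_iff_tendsto_slope_zero.1 hd).mono_left
      (nhdsWithin_mono _ fun x hx => ne_of_gt hx)).eventually_lt_const hneg
  obtain ⟨u, hu, hu0⟩ := (hev.and self_mem_nhdsWithin).exists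
  have hu0 : 0 < u := hu0
  have hlt : f u < 1 := by
    rw [zero_add, smul_eq_mul, hf0] at hu
    have := (mul_neg_iff.1 hu).resolve_right fun h => absurd h.1 (not_lt.2 (inv_pos.2 hu0).le)
    linarith [this.2]
  refine ⟨(c - p) * u, f u, ?_, by positivity, hlt, fun N => ?_⟩
  · have : 0 < (c - p) ^ 2 := by linarith
    nlinarith
  · calc _ ≤ ∑ n ∈ (Finset.range (N + 1)).filter (fun n : ℕ => 0 ≤ (c - p) * u * (n - c * N)),
          binomWeight p q N n * Real.exp ((c - p) * u * (n - c * N)) := by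
          refine Finset.sum_le_sum fun n hn => ?_
          exact le_mul_of_one_le_right (binomWeight_nonneg hp.le hq.le _ _)
            (Real.one_le_exp (Finset.mem_filter.1 hn).2)
      _ ≤ ∑ n ∈ Finset.range (N + 1),
          binomWeight p q N n * Real.exp ((c - p) * u * (n - c * N)) :=
          Finset.sum_le_sum_of_subset_of_nonneg (Finset.filter_subset _ _) fun n _ _ =>
            mul_nonneg (binomWeight_nonneg hp.le hq.le _ _) (Real.exp_pos _).le
      _ = f u ^ N := by
          rw [hf, mul_pow, add_comm q, add_pow, Finset.sum_mul]
          refine Finset.sum_congr rfl fun n _ => ?_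
          have : Real.exp ((c - p) * u * (n - c * N)) =
              Real.exp ((c - p) * u) ^ n * Real.exp (-(c * ((c - p) * u))) ^ N := by
            rw [← Real.exp_nat_mul, ← Real.exp_nat_mul, ← Real.exp_add]
            ring_nf
          rw [this, binomWeight, mul_pow]
          ring

theorem exists_sum_binomWeight_tail_le {p q : ℝ} (hp : 0 < p) (hq : 0 < q) (hpq : p + q = 1)
    {δ : ℝ} (hδ : 0 < δ) : ∃ ρ : ℝ, 0 ≤ ρ ∧ ρ < 1 ∧ ∀ N : ℕ,
      ∑ n ∈ (Finset.range (N + 1)).filter (fun n : ℕ => δ * N ≤ |n - p * N|), binomWeight p q N n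
        ≤ 2 * ρ ^ N := by
  -- one Chernoff bound for each of the half lines on the two sides of the mean
  obtain ⟨s, ρ, hs, hρ0, hρ1, h1⟩ := exists_sum_binomWeight_le_pow hp hq hpq
    (c := p + δ) (by linarith)
  obtain ⟨s', ρ', hs', hρ0', hρ1', h2⟩ := exists_sum_binomWeight_le_pow hp hq hpq
    (c := p - δ) (by linarith)
  have hs : 0 < s := by
    rw [add_sub_cancel_left] at hs
    exact (pos_iff_pos_of_mul_pos hs).2 hδ
  have hs' : s' < 0 := by
    by_contra hcon
    nlinarith [not_lt.1 hcon]
  refine ⟨max ρ ρ', le_max_of_le_left hρ0, max_lt hρ1 hρ1', fun N => ?_⟩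
  have hsub : (Finset.range (N + 1)).filter (fun n : ℕ => δ * N ≤ |n - p * N|) ⊆
      (Finset.range (N + 1)).filter (fun n : ℕ => 0 ≤ s * (n - (p + δ) * N)) ∪
      (Finset.range (N + 1)).filter (fun n : ℕ => 0 ≤ s' * (n - (p - δ) * N)) := by
    intro n hn
    obtain ⟨hn1, hn2⟩ := Finset.mem_filter.1 hn
    rcases le_abs'.1 hn2 with h | h
    · refine Finset.mem_union_right _ (Finset.mem_filter.2 ⟨hn1, ?_⟩)
      exact mul_nonneg_of_nonpos_of_nonpos hs'.le (by linarith)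
    · refine Finset.mem_union_left _ (Finset.mem_filter.2 ⟨hn1, ?_⟩)
      exact mul_nonneg hs.le (by linarith)
  have hnn : ∀ n, 0 ≤ binomWeight p q N n := binomWeight_nonneg hp.le hq.le N
  calc _ ≤ _ := Finset.sum_le_sum_of_subset_of_nonneg hsub fun n _ _ => hnn n
    _ ≤ ∑ n ∈ (Finset.range (N + 1)).filter (fun n : ℕ => 0 ≤ s * (n - (p + δ) * N)),
          binomWeight p q N n + ∑ n ∈ (Finset.range (N + 1)).filter
            (fun n : ℕ => 0 ≤ s' * (n - (p - δ) * N)), binomWeight p q N n := by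
        rw [← Finset.sum_union_inter]
        exact le_add_of_nonneg_right (Finset.sum_nonneg fun n _ => hnn n)
    _ ≤ ρ ^ N + ρ' ^ N := add_le_add (h1 N) (h2 N)
    _ ≤ max ρ ρ' ^ N + max ρ ρ' ^ N := by
        gcongr
        · exact le_max_left _ _
        · exact le_max_right _ _
    _ = 2 * max ρ ρ' ^ N := by ring

/-- The filter of pairs `(N, n)` with `N → ∞` and `n / N → p`. -/
noncomputable def meanFilter (p : ℝ) : Filter (ℕ × ℕ) :=
  comap (fun x : ℕ × ℕ => (x.1, (x.2 : ℝ) / x.1)) (atTop ×ˢ 𝓝 p)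

/-- In a binomial average over any index sets, a polynomially bounded array which converges near
the mean may be replaced by its limit: the mass away from the mean is exponentially small. -/
theorem tendsto_sum_binomWeight_smul {p q : ℝ} (hp : 0 < p) (hq : 0 < q) (hpq : p + q = 1)
    {E : Type*} [NormedAddCommGroup E] [NormedSpace ℂ E] {V : ℕ → ℕ → E} {v : E}
    {C : ℝ} {κ : ℕ} (hbound : ∀ N n, n ≤ N → ‖V N n‖ ≤ C * ((N : ℝ) + 1) ^ κ)
    (hlim : Tendsto (fun x : ℕ × ℕ => V x.1 x.2) (meanFilter p) (𝓝 v))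
    (s : ℕ → Finset ℕ) (hs : ∀ N, s N ⊆ Finset.range (N + 1)) :
    Tendsto (fun N => ∑ n ∈ s N, (binomWeight p q N n : ℂ) • (V N n - v)) atTop (𝓝 0) := by
  have hnn : ∀ N n, 0 ≤ binomWeight p q N n := binomWeight_nonneg hp.le hq.le
  refine NormedAddGroup.tendsto_nhds_zero.2 fun ε hε => ?_
  have hmem := hlim (Metric.ball_mem_nhds v (half_pos hε))
  obtain ⟨U, hU, hUsub⟩ := mem_comap.1 (mem_map.1 hmem)
  obtain ⟨U1, hU1, U2, hU2, hU12⟩ := mem_prod_iff.1 hU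
  obtain ⟨δ, hδ, hδU⟩ := Metric.mem_nhds_iff.1 hU2
  obtain ⟨ρ, hρ0, hρ1, htail⟩ := exists_sum_binomWeight_tail_le hp hq hpq hδ
  set C' := |C| + ‖v‖ with hC'
  have hC'0 : 0 ≤ C' := by positivity
  have hdecay : Tendsto (fun N : ℕ => C' * ((N : ℝ) + 1) ^ κ * (2 * ρ ^ N)) atTop (𝓝 0) := by
    have h1 : Tendsto (fun N : ℕ => (N : ℝ) ^ κ * ρ ^ N) atTop (𝓝 0) :=
      tendsto_pow_const_mul_const_pow_of_lt_one κ hρ0 hρ1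
    have h2 : Tendsto (fun N : ℕ => 2 * C' * 2 ^ κ * ((N : ℝ) ^ κ * ρ ^ N)) atTop (𝓝 0) := by
      simpa using h1.const_mul (2 * C' * 2 ^ κ)
    refine squeeze_zero' (Eventually.of_forall fun N => by positivity) ?_ h2
    filter_upwards [eventually_ge_atTop 1] with N hN
    have hN' : (1 : ℝ) ≤ N := by exact_mod_cast hN
    have : ((N : ℝ) + 1) ^ κ ≤ 2 ^ κ * (N : ℝ) ^ κ := by
      rw [← mul_pow]
      exact pow_le_pow_left₀ (by positivity) (by linarith) _
    calc C' * ((N : ℝ) + 1) ^ κ * (2 * ρ ^ N) ≤ C' * (2 ^ κ * (N : ℝ) ^ κ) * (2 * ρ ^ N) := by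
          gcongr
      _ = _ := by ring
  filter_upwards [hU1, hdecay.eventually_lt_const (half_pos hε), eventually_gt_atTop 0] with
    N hN hdec hN0
  have hN0' : (0 : ℝ) < N := by exact_mod_cast hN0
  have hterm : ∀ n ∈ Finset.range (N + 1), ‖V N n - v‖ ≤
      ε / 2 + if δ * N ≤ |n - p * N| then C' * ((N : ℝ) + 1) ^ κ else 0 := by
    intro n hn
    split_ifs with h
    · have h1 : (1 : ℝ) ≤ ((N : ℝ) + 1) ^ κ := one_le_pow₀ (by linarith)
      have h2 := hbound N n (Nat.lt_succ_iff.1 (Finset.mem_range.1 hn))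
      have h3 : C * ((N : ℝ) + 1) ^ κ ≤ |C| * ((N : ℝ) + 1) ^ κ := by
        gcongr
        exact le_abs_self C
      have h4 : ‖v‖ ≤ ‖v‖ * ((N : ℝ) + 1) ^ κ := le_mul_of_one_le_right (norm_nonneg _) h1
      have h5 := norm_sub_le (V N n) v
      rw [hC', add_mul]
      linarith
    · have hin : (N, n) ∈ (fun x : ℕ × ℕ => (x.1, (x.2 : ℝ) / x.1)) ⁻¹' U := by
        refine hU12 (Set.mk_mem_prod hN (hδU ?_))
        rw [Metric.mem_ball, Real.dist_eq]
        have : (n : ℝ) / N - p = (n - p * N) / N := by field_simp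
        rw [this, abs_div, abs_of_pos hN0', div_lt_iff₀ hN0']
        exact not_le.1 h
      have := hUsub hin
      rw [Set.mem_preimage, Metric.mem_ball, dist_eq_norm] at this
      linarith
  have hle : ‖∑ n ∈ s N, (binomWeight p q N n : ℂ) • (V N n - v)‖ ≤
      ε / 2 + C' * ((N : ℝ) + 1) ^ κ * (2 * ρ ^ N) := by
    calc _ ≤ ∑ n ∈ s N, binomWeight p q N n * ‖V N n - v‖ := by
          refine (norm_sum_le _ _).trans (le_of_eq (Finset.sum_congr rfl fun n _ => ?_))
          rw [norm_smul, Complex.norm_real, Real.norm_of_nonneg (hnn N n)]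
      _ ≤ ∑ n ∈ Finset.range (N + 1), binomWeight p q N n * ‖V N n - v‖ :=
          Finset.sum_le_sum_of_subset_of_nonneg (hs N) fun n _ _ =>
            mul_nonneg (hnn N n) (norm_nonneg _)
      _ ≤ ∑ n ∈ Finset.range (N + 1), binomWeight p q N n *
          (ε / 2 + if δ * N ≤ |n - p * N| then C' * ((N : ℝ) + 1) ^ κ else 0) :=
          Finset.sum_le_sum fun n hn => mul_le_mul_of_nonneg_left (hterm n hn) (hnn N n)
      _ = ε / 2 + C' * ((N : ℝ) + 1) ^ κ * ∑ n ∈ (Finset.range (N + 1)).filter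
            (fun n : ℕ => δ * N ≤ |n - p * N|), binomWeight p q N n := by
          simp only [mul_add, Finset.sum_add_distrib]
          rw [← Finset.sum_mul, sum_binomWeight hpq, one_mul, Finset.sum_filter, Finset.mul_sum]
          congr 1
          refine Finset.sum_congr rfl fun n _ => ?_
          split_ifs <;> ring
      _ ≤ _ := by gcongr; exact htail N
  linarith

end AML

/-! ### Powers and Gamma values at exponents with nilpotent positive part -/

theorem iteratedDeriv_const_cpow {a : ℂ} (ha : a ≠ 0) (k : ℕ) :
    iteratedDeriv k (fun z : ℂ => a ^ z) = fun z => Complex.log a ^ k * a ^ z := by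
  induction k with
  | zero => simp
  | succ k ih =>
    rw [iteratedDeriv_succ, ih]
    funext z
    have h : HasDerivAt (fun z : ℂ => a ^ z) (a ^ z * Complex.log a * 1) z :=
      (hasDerivAt_id z).const_cpow (Or.inl ha)
    rw [(h.const_mul _).deriv]
    ring

namespace AML

section Taylor

variable {A : Type*} [Ring A] [Algebra ℂ A]

/-- The value `∑ k, a k * N ^ k` of a power series at a nilpotent element, a finite sum. -/
noncomputable def taylor (N : A) (a : ℕ → ℂ) : A := ∑ᶠ k : ℕ, a k • N ^ k

theorem support_taylor_subset {N : A} {K : ℕ} (hK : N ^ K = 0) (a : ℕ → ℂ) :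
    (Function.support fun k => a k • N ^ k) ⊆ Finset.range K := by
  intro k hk
  by_contra h
  refine hk ?_
  simp only [Finset.coe_range, Set.mem_Iio, not_lt] at h
  simp [pow_eq_zero_of_le h hK]

theorem taylor_eq_sum {N : A} {K : ℕ} (hK : N ^ K = 0) (a : ℕ → ℂ) :
    taylor N a = ∑ k ∈ Finset.range K, a k • N ^ k :=
  finsum_eq_sum_of_support_subset _ (support_taylor_subset hK a)

theorem taylor_smul {N : A} (hN : IsNilpotent N) (c : ℂ) (a : ℕ → ℂ) :
    taylor N (fun k => c * a k) = c • taylor N a := by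
  obtain ⟨K, hK⟩ := hN
  rw [taylor_eq_sum hK, taylor_eq_sum hK, Finset.smul_sum]
  exact Finset.sum_congr rfl fun k _ => mul_smul _ _ _

theorem commute_taylor {N : A} (hN : IsNilpotent N) (a b : ℕ → ℂ) :
    Commute (taylor N a) (taylor N b) := by
  obtain ⟨K, hK⟩ := hN
  rw [taylor_eq_sum hK, taylor_eq_sum hK]
  refine Commute.sum_left _ _ _ fun i _ => Commute.sum_right _ _ _ fun j _ => ?_
  exact (((Commute.refl N).pow_pow i j).smul_left _).smul_right _

theorem taylor_mem (S : Subalgebra ℂ A) {N : A} (hN : N ∈ S) (a : ℕ → ℂ) : taylor N a ∈ S :=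
  finsum_induction (· ∈ S) S.zero_mem (fun _ _ => S.add_mem)
    fun k => S.smul_mem (S.pow_mem hN k) _

theorem gamma_eq_taylor (ε : A →ₗ[ℂ] ℂ) (γ : A) : gamma ε γ = taylor (pos ε γ)
    fun k => iteratedDeriv k Complex.Gamma (ε γ) / (k.factorial : ℂ) := rfl

theorem power_eq_taylor (ε : A →ₗ[ℂ] ℂ) (t : ℝ) (γ : A) : power ε t γ = ((t : ℂ) ^ ε γ) •
    taylor (pos ε γ) fun k => ((Real.log t : ℝ) : ℂ) ^ k / (k.factorial : ℂ) := rfl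

theorem map_natCast_add {ε : A →ₗ[ℂ] ℂ} (hε : ε 1 = 1) (n : ℕ) (γ : A) :
    ε ((n : A) + γ) = n + ε γ := by
  rw [map_add, ← nsmul_one, map_nsmul, hε, nsmul_one]

theorem pos_natCast_add {ε : A →ₗ[ℂ] ℂ} (hε : ε 1 = 1) (n : ℕ) (γ : A) :
    pos ε ((n : A) + γ) = pos ε γ := by
  rw [pos, pos, map_natCast_add hε, map_add, map_natCast]
  abel

theorem power_natCast_add {ε : A →ₗ[ℂ] ℂ} (hε : ε 1 = 1) {t : ℝ} (ht : 0 < t) (n : ℕ) (γ : A) :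
    power ε t ((n : A) + γ) = (t : ℂ) ^ n • power ε t γ := by
  have ht' : (t : ℂ) ≠ 0 := by exact_mod_cast ht.ne'
  rw [power_eq_taylor, power_eq_taylor, pos_natCast_add hε, map_natCast_add hε,
    Complex.cpow_add _ _ ht', Complex.cpow_natCast, mul_smul]

theorem power_mem {ε : A →ₗ[ℂ] ℂ} (S : Subalgebra ℂ A) {γ : A} (hγ : γ ∈ S) (t : ℝ) :
    power ε t γ ∈ S :=
  S.smul_mem (taylor_mem S (S.sub_mem hγ (S.algebraMap_mem _)) _) _

theorem commute_power_taylor {ε : A →ₗ[ℂ] ℂ} {γ : A} (h : IsNilpotent (pos ε γ)) (t : ℝ)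
    (a : ℕ → ℂ) : Commute (power ε t γ) (taylor (pos ε γ) a) :=
  (commute_taylor h _ _).smul_left _

end Taylor

section Normed

variable {A : Type*} [NormedRing A] [NormedAlgebra ℂ A]

theorem tsum_eq_taylor {N : A} (hN : IsNilpotent N) (a : ℕ → ℂ) :
    ∑' k, a k • N ^ k = taylor N a := by
  obtain ⟨K, hK⟩ := hN
  rw [taylor, tsum_eq_finsum]
  exact (Finset.finite_toSet _).subset (support_taylor_subset hK a)

/-- Polynomial growth of `s ^ γ` in `s` and `s⁻¹`. -/
theorem exists_norm_power_le {ε : A →ₗ[ℂ] ℂ} {γ : A} (hN : IsNilpotent (pos ε γ)) :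
    ∃ (C : ℝ) (κ : ℕ), 0 ≤ C ∧ ∀ s R : ℝ, 0 < s → s ≤ R → s⁻¹ ≤ R →
      ‖power ε s γ‖ ≤ C * R ^ κ := by
  obtain ⟨K, hK⟩ := hN
  obtain ⟨M, hM⟩ := exists_nat_gt |(ε γ).re|
  refine ⟨∑ k ∈ Finset.range K, ‖pos ε γ ^ k‖, M + 1,
    Finset.sum_nonneg fun _ _ => norm_nonneg _, fun s R hs hsR hsR' => ?_⟩
  have hR : 0 < R := hs.trans_le hsR
  have hlog : |Real.log s| ≤ Real.log R := by
    refine abs_le.2 ⟨?_, Real.log_le_log hs hsR⟩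
    have := Real.log_le_log (inv_pos.2 hs) hsR'
    rw [Real.log_inv] at this
    linarith
  have hexp : Real.exp |Real.log s| ≤ R := by
    rw [← Real.exp_log hR]
    exact Real.exp_le_exp.2 hlog
  have h1 : s ^ (ε γ).re ≤ R ^ M := by
    rw [Real.rpow_def_of_pos hs]
    calc Real.exp (Real.log s * (ε γ).re) ≤ Real.exp (M * |Real.log s|) := by
          refine Real.exp_le_exp.2 ((le_abs_self _).trans ?_)
          rw [abs_mul, mul_comm]
          gcongr
      _ = Real.exp |Real.log s| ^ M := Real.exp_nat_mul _ _
      _ ≤ R ^ M := by gcongr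
  have h2 : ∀ k, ‖(((Real.log s : ℝ) : ℂ) ^ k / (k.factorial : ℂ)) • pos ε γ ^ k‖ ≤
      R * ‖pos ε γ ^ k‖ := by
    intro k
    rw [norm_smul, norm_div, norm_pow, Complex.norm_real, Complex.norm_natCast, Real.norm_eq_abs]
    gcongr
    exact (Real.pow_div_factorial_le_exp _ (abs_nonneg _) k).trans hexp
  rw [power_eq_taylor, norm_smul, Complex.norm_cpow_eq_rpow_re_of_pos hs, taylor_eq_sum hK]
  calc _ ≤ R ^ M * ∑ k ∈ Finset.range K, R * ‖pos ε γ ^ k‖ := by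
        gcongr
        exact (norm_sum_le _ _).trans (Finset.sum_le_sum fun k _ => h2 k)
    _ = _ := by rw [← Finset.mul_sum]; ring

/-- Power series at a nilpotent element multiply by the Cauchy product. -/
theorem taylor_mul {N : A} (hN : IsNilpotent N) (a b : ℕ → ℂ) :
    taylor N a * taylor N b =
      taylor N fun k => ∑ ij ∈ Finset.HasAntidiagonal.antidiagonal k, a ij.1 * b ij.2 := by
  have ⟨K, hK⟩ := hN
  have hs : ∀ a : ℕ → ℂ, (Function.support fun k => a k • N ^ k).Finite := fun a =>
    (Finset.finite_toSet _).subset (support_taylor_subset hK a)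
  rw [← tsum_eq_taylor hN, ← tsum_eq_taylor hN, ← tsum_eq_taylor hN,
    Summable.tsum_mul_tsum_eq_tsum_sum_antidiagonal (summable_of_hasFiniteSupport (hs a))
      (summable_of_hasFiniteSupport (hs b))]
  · refine tsum_congr fun k => ?_
    rw [Finset.sum_smul]
    refine Finset.sum_congr rfl fun ij hij => ?_
    rw [smul_mul_smul_comm, ← pow_add, Finset.HasAntidiagonal.mem_antidiagonal.1 hij]
  · refine summable_of_hasFiniteSupport (((hs a).prod (hs b)).subset fun x hx => ?_)
    exact ⟨fun h => hx (by simp [h]), fun h => hx (by simp [h])⟩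

theorem power_eq_exp {ε : A →ₗ[ℂ] ℂ} {γ : A} (hN : IsNilpotent (pos ε γ)) (t : ℝ) :
    power ε t γ =
      ((t : ℂ) ^ ε γ) • NormedSpace.exp (((Real.log t : ℝ) : ℂ) • pos ε γ) := by
  rw [power_eq_taylor, ← tsum_eq_taylor hN, NormedSpace.exp_eq_tsum ℂ]
  congr 1
  refine tsum_congr fun k => ?_
  rw [smul_pow, smul_smul, div_eq_inv_mul]

theorem power_one {ε : A →ₗ[ℂ] ℂ} {γ : A} (hN : IsNilpotent (pos ε γ)) : power ε 1 γ = 1 := by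
  rw [power_eq_exp hN]
  simp

/-- The value of `Γ(1 + n + z) / (n! n ^ z)` at `z = γ`. -/
noncomputable def gammaFactor (ε : A →ₗ[ℂ] ℂ) (γ : A) (n : ℕ) : A :=
  taylor (pos ε γ) fun k => iteratedDeriv k (gammaRatio n) (ε γ) / (k.factorial : ℂ)

theorem tendsto_gammaFactor {ε : A →ₗ[ℂ] ℂ} {γ : A} (hN : IsNilpotent (pos ε γ)) :
    Tendsto (gammaFactor ε γ) atTop (𝓝 1) := by
  obtain ⟨K, hK⟩ := hN
  have hK' : pos ε γ ^ (K + 1) = 0 := by rw [pow_succ, hK, zero_mul]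
  have h : ∀ k ∈ Finset.range (K + 1), Tendsto (fun n : ℕ =>
      (iteratedDeriv k (gammaRatio n) (ε γ) / (k.factorial : ℂ)) • pos ε γ ^ k) atTop
      (𝓝 (((if k = 0 then 1 else 0) / (k.factorial : ℂ)) • pos ε γ ^ k)) := fun k _ =>
    ((tendsto_iteratedDeriv_gammaRatio _ k).div_const _).smul_const _
  have hs := tendsto_finsetSum _ h
  simp only [← taylor_eq_sum hK'] at hs
  have h1 : (taylor (pos ε γ) fun k => (if k = 0 then 1 else 0) / (k.factorial : ℂ)) = 1 := by
    rw [taylor_eq_sum hK', Finset.sum_range_succ']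
    simp
  rwa [h1] at hs

/-- Leibniz' rule for the derivatives of `Γ(1 + n + z) = n! n ^ z gammaRatio n z`, evaluated at `γ`.
The bound on `n` keeps `γ₀` away from the poles. -/
theorem gamma_one_add {ε : A →ₗ[ℂ] ℂ} (hε : ε 1 = 1) {γ : A} (hN : IsNilpotent (pos ε γ))
    {n : ℕ} {K : ℕ} (hγ : |(ε γ).re| < K) (hn : K < n) :
    gamma ε (1 + (n : A) + γ) = (n.factorial : ℂ) • (power ε n γ * gammaFactor ε γ n) := by
  have hn0 : (n : ℂ) ≠ 0 := by exact_mod_cast (by omega : n ≠ 0)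
  have hfac : (n.factorial : ℂ) ≠ 0 := by exact_mod_cast n.factorial_ne_zero
  have h1 : (1 + (n : A) + γ) = ((n + 1 : ℕ) : A) + γ := by push_cast; abel
  rw [gamma_eq_taylor, h1, pos_natCast_add hε, map_natCast_add hε, power_eq_taylor,
    gammaFactor, smul_mul_assoc, taylor_mul hN, smul_smul, ← taylor_smul hN]
  congr 1
  funext k
  have hf : (fun z => Complex.Gamma (((n + 1 : ℕ) : ℂ) + z)) =
      fun z => (n.factorial : ℂ) * ((n : ℂ) ^ z * gammaRatio n z) := by
    funext z
    have : (n : ℂ) ^ z ≠ 0 := (Complex.cpow_ne_zero_iff).2 (Or.inl hn0)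
    rw [gammaRatio]
    push_cast
    rw [add_comm (n : ℂ) 1]
    field_simp
  have hcd1 : ContDiffAt ℂ k (fun z : ℂ => (n : ℂ) ^ z) (ε γ) := by
    have : Differentiable ℂ (fun z : ℂ => (n : ℂ) ^ z) := fun z =>
      ((hasDerivAt_id z).const_cpow (Or.inl hn0)).differentiableAt
    exact this.contDiff.contDiffAt
  have hcd2 : ContDiffAt ℂ k (gammaRatio n) (ε γ) := by
    refine AnalyticAt.contDiffAt (DifferentiableOn.analyticAt
      (s := {z : ℂ | |z.re| < K}) (fun z hz =>
        (differentiableAt_gammaRatio hn hz).differentiableWithinAt) ?_)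
    exact (isOpen_lt (Complex.continuous_re.abs) continuous_const).mem_nhds hγ
  have hlog : ((Real.log n : ℝ) : ℂ) = Complex.log n := Complex.natCast_log.symm ▸ rfl
  rw [← congrFun (iteratedDeriv_comp_const_add k Complex.Gamma _) (ε γ), hf,
    iteratedDeriv_const_mul_field, iteratedDeriv_fun_mul hcd1 hcd2, Finset.mul_sum,
    Finset.Nat.sum_antidiagonal_eq_sum_range_succ_mk, Finset.sum_div, Finset.mul_sum]
  refine Finset.sum_congr rfl fun i hi => ?_
  have hik : i ≤ k := Nat.lt_succ_iff.1 (Finset.mem_range.1 hi)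
  rw [iteratedDeriv_const_cpow hn0, Nat.cast_choose ℂ hik, Complex.natCast_log]
  have f1 : (k.factorial : ℂ) ≠ 0 := by exact_mod_cast k.factorial_ne_zero
  simp only [Complex.ofReal_natCast]
  field_simp

/-- The normalization of the coefficient `c` at index `n`; an asymptotically Mittag-Leffler series
is one whose normalized coefficients converge. It is `n! T ^ (-n) (n / T) ^ γ c` for `n > 0`; the
maximum with `1` keeps the base of the power positive at `n = 0`. -/
noncomputable def normalize (ε : A →ₗ[ℂ] ℂ) (γ : A) (T : ℝ) (n : ℕ) (c : A) : A :=
  ((n.factorial : ℂ) / (T : ℂ) ^ n) • (power ε (((max n 1 : ℕ) : ℝ) / T) γ * c)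

variable [FiniteDimensional ℂ A]

theorem power_mul {ε : A →ₗ[ℂ] ℂ} {γ : A} (hN : IsNilpotent (pos ε γ)) {s t : ℝ} (hs : 0 < s)
    (ht : 0 < t) : power ε s γ * power ε t γ = power ε (s * t) γ := by
  have : CompleteSpace A := FiniteDimensional.complete ℂ A
  let _ : NormedAlgebra ℚ A := NormedAlgebra.restrictScalars ℚ ℂ A
  rw [power_eq_exp hN, power_eq_exp hN, power_eq_exp hN, smul_mul_smul_comm,
    ← NormedSpace.exp_add_of_commute (((Commute.refl _).smul_left _).smul_right _), ← add_smul,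
    Complex.ofReal_mul, Complex.mul_cpow_ofReal_nonneg hs.le ht.le, Real.log_mul hs.ne' ht.ne',
    Complex.ofReal_add]

theorem tendsto_power_one {ε : A →ₗ[ℂ] ℂ} {γ : A} (hN : IsNilpotent (pos ε γ)) :
    Tendsto (fun s => power ε s γ) (𝓝 1) (𝓝 1) := by
  have : CompleteSpace A := FiniteDimensional.complete ℂ A
  let _ : NormedAlgebra ℚ A := NormedAlgebra.restrictScalars ℚ ℂ A
  have h : ContinuousAt (fun s => power ε s γ) 1 := by
    simp only [power_eq_exp hN]
    refine ContinuousAt.smul ?_ ?_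
    · exact Complex.continuous_ofReal.continuousAt.cpow continuousAt_const (by simp)
    · refine NormedSpace.exp_continuous.continuousAt.comp (ContinuousAt.smul ?_ continuousAt_const)
      exact Complex.continuous_ofReal.continuousAt.comp (Real.continuousAt_log one_ne_zero)
  simpa [ContinuousAt, power_one hN] using h

/-- A coefficient is recovered from its normalization. -/
theorem eq_smul_power_mul_normalize {ε : A →ₗ[ℂ] ℂ} {γ : A} (hN : IsNilpotent (pos ε γ)) {T : ℝ}
    (hT : 0 < T) (n : ℕ) (c : A) : c = ((T : ℂ) ^ n / n.factorial) •
      (power ε (T / ((max n 1 : ℕ) : ℝ)) γ * normalize ε γ T n c) := by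
  have hT' : (T : ℂ) ≠ 0 := by exact_mod_cast hT.ne'
  have hfac : (n.factorial : ℂ) ≠ 0 := by exact_mod_cast n.factorial_ne_zero
  have hm : (0 : ℝ) < ((max n 1 : ℕ) : ℝ) := by exact_mod_cast (by omega : 0 < max n 1)
  rw [normalize, mul_smul_comm, smul_smul, ← mul_assoc, power_mul hN (div_pos hT hm)
    (div_pos hm hT), div_mul_div_cancel₀ hm.ne', div_self hT.ne', power_one hN, one_mul,
    div_mul_div_cancel₀ hfac, div_self (pow_ne_zero _ hT'), one_smul]

theorem normalize_injective {ε : A →ₗ[ℂ] ℂ} {γ : A} (hN : IsNilpotent (pos ε γ)) {T : ℝ}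
    (hT : 0 < T) (n : ℕ) : Function.Injective (normalize ε γ T n) := fun c c' h => by
  rw [eq_smul_power_mul_normalize hN hT n c, h, ← eq_smul_power_mul_normalize hN hT n c']

/-- The Mittag-Leffler coefficient with amplitude `x`, in terms of normalized coefficients. -/
theorem eq_power_mul_inverse_gamma_mul_iff {ε : A →ₗ[ℂ] ℂ} (hε : ε 1 = 1) {β : A}
    (hN : IsNilpotent (pos ε β)) {T : ℝ} (hT : 0 < T) {n K : ℕ} (hγ : |(ε β).re| < K)
    (hn : K < n) (hD : IsUnit (gammaFactor ε β n)) (c x : A) :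
    c = power ε T ((n : A) + β) * Ring.inverse (gamma ε (1 + (n : A) + β)) * x ↔
      gammaFactor ε β n * normalize ε β T n c = x := by
  have hT' : (T : ℂ) ≠ 0 := by exact_mod_cast hT.ne'
  have hn' : (0 : ℝ) < (n : ℝ) := by exact_mod_cast (by omega : 0 < n)
  have hfac : (n.factorial : ℂ) ≠ 0 := by exact_mod_cast n.factorial_ne_zero
  set D := gammaFactor ε β n
  set g := gamma ε (1 + (n : A) + β)
  have hgD : g = (n.factorial : ℂ) • (D * power ε n β) := by
    have hcomm : Commute (power ε n β) D := commute_power_taylor hN _ _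
    rw [← hcomm.eq]
    exact gamma_one_add hε hN hγ hn
  have hgunit : IsUnit g := by
    have hp : IsUnit (power ε n β) := by
      refine ⟨⟨power ε n β, power ε (n : ℝ)⁻¹ β, ?_, ?_⟩, rfl⟩
      · rw [power_mul hN hn' (inv_pos.2 hn'), mul_inv_cancel₀ hn'.ne', power_one hN]
      · rw [power_mul hN (inv_pos.2 hn') hn', inv_mul_cancel₀ hn'.ne', power_one hN]
    rw [hgD, Algebra.smul_def]
    exact ((IsUnit.mk0 _ hfac).map _).mul (hD.mul hp)
  have forward : ∀ x, D * normalize ε β T n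
      (power ε T ((n : A) + β) * Ring.inverse g * x) = x := by
    intro x
    have h1 : ((max n 1 : ℕ) : ℝ) = n := by exact_mod_cast (by omega : max n 1 = n)
    have h2 : power ε (n / T) β * power ε T β = power ε n β := by
      rw [power_mul hN (div_pos hn' hT) hT, div_mul_cancel₀ _ hT.ne']
    calc _ = ((n.factorial : ℂ) / (T : ℂ) ^ n * (T : ℂ) ^ n) •
          (D * (power ε (n / T) β * power ε T β) * Ring.inverse g * x) := by
          rw [normalize, h1, power_natCast_add hε hT]
          simp only [smul_mul_assoc, mul_smul_comm, smul_smul, mul_assoc]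
      _ = g * Ring.inverse g * x := by
          rw [h2, div_mul_cancel₀ _ (pow_ne_zero _ hT'), hgD]
          simp only [smul_mul_assoc]
      _ = x := by rw [Ring.mul_inverse_cancel _ hgunit, one_mul]
  refine ⟨fun h => by rw [h, forward], fun h => ?_⟩
  refine normalize_injective hN hT n (hD.mul_left_cancel ?_)
  rw [h, forward]

/-- Since `Γ(1 + n + β) = n! n ^ β (1 + o(1))`, the Mittag-Leffler asymptotics of `c` say that
`n! T ^ (-n) (n / T) ^ β c` converges, where `n = r m`. -/
theorem isAML_iff {ε : A →ₗ[ℂ] ℂ} (hε : ε 1 = 1) {β : A} (hN : IsNilpotent (pos ε β)) (r : ℕ)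
    (c : ℕ → A) (T : ℝ) (S : A) :
    IsAML ε r β c T S ↔ 0 < r ∧ 0 < T ∧
      Tendsto (fun m => normalize ε β T (r * m) (c m)) atTop (𝓝 S) := by
  have : CompleteSpace A := FiniteDimensional.complete ℂ A
  refine and_congr_right fun hr => and_congr_right fun hT => ?_
  have hrm : Tendsto (fun m : ℕ => r * m) atTop atTop := tendsto_id.const_mul_atTop' hr
  obtain ⟨K, hγ⟩ := exists_nat_gt |(ε β).re|
  set D : ℕ → A := fun m => gammaFactor ε β (r * m)
  have hD1 : Tendsto D atTop (𝓝 1) := (tendsto_gammaFactor hN).comp hrm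
  have hDunit : ∀ᶠ m in atTop, IsUnit (D m) := hD1.eventually (Units.nhds (1 : Aˣ))
  have hDinv : Tendsto (fun m => Ring.inverse (D m)) atTop (𝓝 1) := by
    have h : Tendsto Ring.inverse (𝓝 (1 : A)) (𝓝 1) := by
      simpa [ContinuousAt] using NormedRing.inverse_continuousAt (1 : Aˣ)
    exact h.comp hD1
  have hiff : ∀ᶠ m : ℕ in atTop, ∀ x : A, c m = power ε T (((r * m : ℕ) : A) + β) *
      Ring.inverse (gamma ε (1 + ((r * m : ℕ) : A) + β)) * x ↔
        D m * normalize ε β T (r * m) (c m) = x := by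
    filter_upwards [hDunit, hrm.eventually_gt_atTop K] with m hm hmK x
    exact eq_power_mul_inverse_gamma_mul_iff hε hN hT hγ hmK hm _ _
  constructor
  · rintro ⟨R, hR, hc⟩
    have hlim : Tendsto (fun m => Ring.inverse (D m) * (S + R m)) atTop (𝓝 S) := by
      simpa using hDinv.mul (hR.const_add S)
    refine hlim.congr' ?_
    filter_upwards [hc, hiff, hDunit] with m h1 h2 h3
    rw [← (h2 _).1 h1, Ring.inverse_mul_cancel_left _ _ h3]
  · intro h
    refine ⟨fun m => D m * normalize ε β T (r * m) (c m) - S, ?_, ?_⟩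
    · simpa using (hD1.mul h).sub_const S
    · filter_upwards [hiff] with m hm
      rw [hm]
      abel

end Normed

end AML

/-! ### Products of series under a signed tensor product -/

/-- A pair `(i, j)` with `p i + q j = N` is determined by `n = p i`. -/
theorem Finset.sum_filter_mul_add_mul_eq {M : Type*} [AddCommMonoid M] {p q : ℕ} (hp : 0 < p)
    (hq : 0 < q) (N : ℕ) (F : ℕ → ℕ → M) :
    ∑ ij ∈ (Finset.range (N + 1) ×ˢ Finset.range (N + 1)).filter
      (fun ij => p * ij.1 + q * ij.2 = N), F ij.1 ij.2 =
    ∑ n ∈ (Finset.range (N + 1)).filter (fun n => p ∣ n ∧ q ∣ N - n),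
      F (n / p) ((N - n) / q) := by
  refine Finset.sum_bij' (fun ij _ => p * ij.1) (fun n _ => (n / p, (N - n) / q)) ?_ ?_ ?_ ?_ ?_
  · rintro ⟨i, j⟩ h
    obtain ⟨-, h⟩ := Finset.mem_filter.1 h
    dsimp only at h ⊢
    refine Finset.mem_filter.2 ⟨Finset.mem_range.2 (by omega), Dvd.intro _ rfl, ?_⟩
    exact ⟨j, by omega⟩
  · intro n h
    obtain ⟨hn, ⟨i, rfl⟩, ⟨j, hj⟩⟩ := Finset.mem_filter.1 h
    rw [Finset.mem_range] at hn
    have hi := Nat.le_mul_of_pos_left i hp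
    have hj' := Nat.le_mul_of_pos_left j hq
    simp only [hj, Nat.mul_div_cancel_left _ hp, Nat.mul_div_cancel_left _ hq, Finset.mem_filter,
      Finset.mem_product, Finset.mem_range]
    omega
  · rintro ⟨i, j⟩ h
    obtain ⟨-, h⟩ := Finset.mem_filter.1 h
    dsimp only at h ⊢
    have : N - p * i = q * j := by omega
    simp [this, hp, hq]
  · intro n h
    exact Nat.mul_div_cancel' (Finset.mem_filter.1 h).2.1
  · rintro ⟨i, j⟩ h
    obtain ⟨-, h⟩ := Finset.mem_filter.1 h
    dsimp only at h ⊢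
    have : N - p * i = q * j := by omega
    simp [this, hp, hq]

namespace AML

section Pairing

variable {A A' B : Type*} [Ring A] [Algebra ℂ A] [Ring A'] [Algebra ℂ A'] [Ring B] [Algebra ℂ B]

/-- `a'` may be moved past all right hand factors, as classes of even degree can. -/
def LeftEven (τ : A →ₗ[ℂ] A' →ₗ[ℂ] B) (a' : A) : Prop :=
  ∀ a b b', τ a b * τ a' b' = τ (a * a') (b * b')

/-- `b` may be moved past all left hand factors, as classes of even degree can. -/
def RightEven (τ : A →ₗ[ℂ] A' →ₗ[ℂ] B) (b : A') : Prop :=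
  ∀ a a' b', τ a b * τ a' b' = τ (a * a') (b * b')

/-- The bilinear map `τ` makes `B` a tensor product of algebras up to signs, and these signs do not
occur for the elements `β` and `β'`. -/
structure IsSignedTensor (τ : A →ₗ[ℂ] A' →ₗ[ℂ] B) (β : A) (β' : A') : Prop where
  map_one : τ 1 1 = 1
  leftEven_one : LeftEven τ 1
  rightEven_one : RightEven τ 1
  leftEven : LeftEven τ β
  rightEven : RightEven τ β'

namespace IsSignedTensor

variable {τ : A →ₗ[ℂ] A' →ₗ[ℂ] B} {β : A} {β' : A'}

/-- The elements that may be moved past all right hand factors form a subalgebra. -/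
def leftSubalgebra (h : IsSignedTensor τ β β') : Subalgebra ℂ A where
  carrier := {a | LeftEven τ a}
  mul_mem' {x y} hx hy a b b' := by
    have h1 := h.rightEven_one x y b'
    rw [one_mul] at h1
    rw [← h1, ← mul_assoc, hx, hy, mul_one, mul_assoc]
  add_mem' {x y} hx hy a b b' := by
    simp only [map_add, LinearMap.add_apply, mul_add, hx a b b', hy a b b']
  algebraMap_mem' c a b b' := by
    simp only [Algebra.algebraMap_eq_smul_one, map_smul, LinearMap.smul_apply, mul_smul_comm,
      h.leftEven_one a b b']

/-- The elements that may be moved past all left hand factors form a subalgebra. -/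
def rightSubalgebra (h : IsSignedTensor τ β β') : Subalgebra ℂ A' where
  carrier := {b | RightEven τ b}
  mul_mem' {x y} hx hy a a' b' := by
    have h1 := h.leftEven_one a x y
    rw [mul_one] at h1
    rw [← h1, mul_assoc, hy, hx, one_mul, mul_assoc]
  add_mem' {x y} hx hy a a' b' := by
    simp only [map_add, add_mul, hx a a' b', hy a a' b']
  algebraMap_mem' c a a' b' := by
    simp only [Algebra.algebraMap_eq_smul_one, map_smul, smul_mul_assoc, h.rightEven_one a a' b']

/-- The algebra map `a ↦ a ⊗ 1`. -/
def inclLeft (h : IsSignedTensor τ β β') : A →ₐ[ℂ] B :=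
  AlgHom.ofLinearMap (τ.flip 1) h.map_one fun x y => by
    have := h.rightEven_one x y 1
    rw [mul_one] at this
    exact this.symm

/-- The algebra map `b ↦ 1 ⊗ b`. -/
def inclRight (h : IsSignedTensor τ β β') : A' →ₐ[ℂ] B :=
  AlgHom.ofLinearMap (τ 1) h.map_one fun x y => by
    have := h.leftEven_one 1 x y
    rw [mul_one] at this
    exact this.symm

theorem inclLeft_mul_inclRight (h : IsSignedTensor τ β β') (a : A) (b : A') :
    h.inclLeft a * h.inclRight b = τ a b := by
  have := h.leftEven_one a 1 b
  rwa [mul_one, one_mul] at this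

variable {ε : A →ₗ[ℂ] ℂ} {ε' : A' →ₗ[ℂ] ℂ} {εB : B →ₗ[ℂ] ℂ}

theorem pos_add (h : IsSignedTensor τ β β') (hεB : εB (τ β 1 + τ 1 β') = ε β + ε' β') :
    pos εB (τ β 1 + τ 1 β') = h.inclLeft (pos ε β) + h.inclRight (pos ε' β') := by
  have h1 : h.inclLeft β = τ β 1 := rfl
  have h2 : h.inclRight β' = τ 1 β' := rfl
  rw [pos, pos, pos, hεB, map_sub, map_sub, AlgHom.commutes, AlgHom.commutes, map_add, h1, h2]
  abel

theorem commute_pos (h : IsSignedTensor τ β β') :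
    Commute (h.inclLeft (pos ε β)) (h.inclRight (pos ε' β')) := by
  have hmem : pos ε' β' ∈ h.rightSubalgebra :=
    sub_mem (show β' ∈ h.rightSubalgebra from h.rightEven) (algebraMap_mem _ _)
  have h1 : RightEven τ (pos ε' β') := hmem
  have h2 := h1 1 (pos ε β) 1
  rw [one_mul, mul_one] at h2
  exact (h.inclLeft_mul_inclRight _ _).trans h2.symm

theorem isNilpotent_pos (h : IsSignedTensor τ β β') (hεB : εB (τ β 1 + τ 1 β') = ε β + ε' β')
    (hN : IsNilpotent (pos ε β)) (hN' : IsNilpotent (pos ε' β')) :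
    IsNilpotent (pos εB (τ β 1 + τ 1 β')) := by
  rw [h.pos_add hεB]
  exact h.commute_pos.isNilpotent_add (hN.map _) (hN'.map _)

end IsSignedTensor

/-- The coefficients of the product of two series with periods `p` and `q`. -/
def pairCoeff (τ : A →ₗ[ℂ] A' →ₗ[ℂ] B) (p q : ℕ) (a : ℕ → A) (b : ℕ → A') (m : ℕ) : B :=
  ∑ ij ∈ (Finset.range (Nat.gcd p q * m + 1) ×ˢ Finset.range (Nat.gcd p q * m + 1)).filter
      (fun ij => p * ij.1 + q * ij.2 = Nat.gcd p q * m), τ (a ij.1) (b ij.2)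

end Pairing

section Normed

variable {A A' B : Type*} [NormedRing A] [NormedAlgebra ℂ A]
  [NormedRing A'] [NormedAlgebra ℂ A'] [FiniteDimensional ℂ A']
  [NormedRing B] [NormedAlgebra ℂ B]
  {τ : A →ₗ[ℂ] A' →ₗ[ℂ] B} {β : A} {β' : A'}
  {ε : A →ₗ[ℂ] ℂ} {ε' : A' →ₗ[ℂ] ℂ} {εB : B →ₗ[ℂ] ℂ}

/-- The rescaled terms of a convergent sequence grow at most polynomially in `N`, uniformly in
`k ≤ N`. -/
theorem exists_norm_power_mul_le (hN : IsNilpotent (pos ε β)) {S : A} {u : ℕ → A}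
    (hu : Tendsto u atTop (𝓝 S)) {T₁ T : ℝ} (hT₁ : 0 < T₁) (hT : T₁ ≤ T) :
    ∃ (C : ℝ) (κ : ℕ), 0 ≤ C ∧ ∀ N k i : ℕ, k ≤ N →
      ‖power ε (((max N 1 : ℕ) : ℝ) / T * (T₁ / ((max k 1 : ℕ) : ℝ))) β * u i‖ ≤
        C * ((N : ℝ) + 1) ^ κ := by
  obtain ⟨C, κ, hC, hpow⟩ := exists_norm_power_le hN
  obtain ⟨M, hM⟩ := (Metric.isBounded_range_of_tendsto u hu).exists_norm_le
  have hT0 : 0 < T := hT₁.trans_le hT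
  have hM0 : 0 ≤ M := (norm_nonneg _).trans (hM _ ⟨0, rfl⟩)
  refine ⟨C * (T / T₁) ^ κ * M, κ, by positivity, fun N k i hk => ?_⟩
  have hk1 : (1 : ℝ) ≤ ((max k 1 : ℕ) : ℝ) := by exact_mod_cast le_max_right _ _
  have hkN : ((max k 1 : ℕ) : ℝ) ≤ ((max N 1 : ℕ) : ℝ) := by
    exact_mod_cast max_le_max_right 1 hk
  have hN1 : ((max N 1 : ℕ) : ℝ) ≤ N + 1 := by
    exact_mod_cast (by omega : max N 1 ≤ N + 1)
  have hTT : 1 ≤ T / T₁ := (one_le_div hT₁).2 hT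
  set K : ℝ := ((max k 1 : ℕ) : ℝ)
  set L : ℝ := ((max N 1 : ℕ) : ℝ)
  have hK0 : 0 < K := by linarith
  have hL0 : 0 < L := by linarith
  have h1 := hpow (L / T * (T₁ / K)) (T / T₁ * (N + 1)) (by positivity) (by
    calc L / T * (T₁ / K) = (T₁ / T) * (L / K) := by field_simp
      _ ≤ 1 * L := by
        gcongr
        · exact (div_le_one hT0).2 hT
        · exact div_le_self hL0.le hk1
      _ ≤ T / T₁ * (N + 1) := by gcongr) (by
    calc (L / T * (T₁ / K))⁻¹ = (T / T₁) * (K / L) := by field_simp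
      _ ≤ (T / T₁) * 1 := by
        gcongr
        exact (div_le_one hL0).2 hkN
      _ ≤ T / T₁ * (N + 1) := by
        gcongr
        linarith [Nat.cast_nonneg (α := ℝ) N])
  calc _ ≤ (C * (T / T₁ * (N + 1)) ^ κ) * M :=
        (norm_mul_le _ _).trans (mul_le_mul h1 (hM _ ⟨i, rfl⟩) (norm_nonneg _) (by positivity))
    _ = _ := by rw [mul_pow]; ring

variable [FiniteDimensional ℂ A]

/-- A bilinear map of finite-dimensional spaces, as a continuous bilinear map. -/
noncomputable def bilinCLM (τ : A →ₗ[ℂ] A' →ₗ[ℂ] B) : A →L[ℂ] A' →L[ℂ] B :=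
  LinearMap.toContinuousLinearMap
    ((LinearMap.toContinuousLinearMap (𝕜 := ℂ) (E := A') (F' := B)).toLinearMap ∘ₗ τ)

variable [FiniteDimensional ℂ B]

namespace IsSignedTensor

theorem power_add (h : IsSignedTensor τ β β') (hεB : εB (τ β 1 + τ 1 β') = ε β + ε' β')
    (hN : IsNilpotent (pos ε β)) (hN' : IsNilpotent (pos ε' β')) {s : ℝ} (hs : 0 < s) :
    power εB s (τ β 1 + τ 1 β') = τ (power ε s β) (power ε' s β') := by
  have : CompleteSpace A := FiniteDimensional.complete ℂ A
  have : CompleteSpace A' := FiniteDimensional.complete ℂ A'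
  have : CompleteSpace B := FiniteDimensional.complete ℂ B
  let _ : NormedAlgebra ℚ A := NormedAlgebra.restrictScalars ℚ ℂ A
  let _ : NormedAlgebra ℚ A' := NormedAlgebra.restrictScalars ℚ ℂ A'
  let _ : NormedAlgebra ℚ B := NormedAlgebra.restrictScalars ℚ ℂ B
  have hs' : (s : ℂ) ≠ 0 := by exact_mod_cast hs.ne'
  have hl : Continuous h.inclLeft :=
    LinearMap.continuous_of_finiteDimensional h.inclLeft.toLinearMap
  have hr : Continuous h.inclRight :=
    LinearMap.continuous_of_finiteDimensional h.inclRight.toLinearMap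
  rw [power_eq_exp (h.isNilpotent_pos hεB hN hN'), power_eq_exp hN, power_eq_exp hN',
    h.pos_add hεB, hεB, smul_add, NormedSpace.exp_add_of_commute
      ((h.commute_pos.smul_left _).smul_right _), ← map_smul, ← map_smul,
    ← NormedSpace.map_exp h.inclLeft hl, ← NormedSpace.map_exp h.inclRight hr,
    inclLeft_mul_inclRight, map_smul, map_smul τ, LinearMap.smul_apply, smul_smul,
    Complex.cpow_add _ _ hs', mul_comm]

theorem mul_power (h : IsSignedTensor τ β β') (hεB : εB (τ β 1 + τ 1 β') = ε β + ε' β')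
    (hN : IsNilpotent (pos ε β)) (hN' : IsNilpotent (pos ε' β')) {s : ℝ} (hs : 0 < s)
    (a : A) (b : A') : τ a b * power εB s (τ β 1 + τ 1 β') =
      τ (a * power ε s β) (b * power ε' s β') := by
  rw [h.power_add hεB hN hN' hs]
  exact power_mem h.leftSubalgebra (show β ∈ h.leftSubalgebra from h.leftEven) s a b _

theorem power_mul (h : IsSignedTensor τ β β') (hεB : εB (τ β 1 + τ 1 β') = ε β + ε' β')
    (hN : IsNilpotent (pos ε β)) (hN' : IsNilpotent (pos ε' β')) {s : ℝ} (hs : 0 < s)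
    (a : A) (b : A') : power εB s (τ β 1 + τ 1 β') * τ a b =
      τ (power ε s β * a) (power ε' s β' * b) := by
  rw [h.power_add hεB hN hN' hs]
  exact power_mem h.rightSubalgebra (show β' ∈ h.rightSubalgebra from h.rightEven) s _ a b

end IsSignedTensor

/-- In finite dimension summable series are absolutely summable, so that their products under a
bilinear map are summable in any order. -/
theorem hasSum_bilin (τ : A →ₗ[ℂ] A' →ₗ[ℂ] B) {f : ℕ → A} {g : ℕ → A'} {x : A} {y : A'}
    (hf : HasSum f x) (hg : HasSum g y) :
    HasSum (fun ij : ℕ × ℕ => τ (f ij.1) (g ij.2)) (τ x y) := by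
  have : CompleteSpace B := FiniteDimensional.complete ℂ B
  have hS : Summable fun ij : ℕ × ℕ => τ (f ij.1) (g ij.2) := by
    have h1 := (hf.summable.norm.mul_of_nonneg hg.summable.norm (fun _ => norm_nonneg _)
      (fun _ => norm_nonneg _)).mul_left ‖bilinCLM τ‖
    refine Summable.of_norm_bounded h1 fun ij => ?_
    rw [← mul_assoc]
    exact (bilinCLM τ).le_opNorm₂ _ _
  have h1 : HasSum (fun i => τ (f i) y) (∑' ij : ℕ × ℕ, τ (f ij.1) (g ij.2)) :=
    hS.hasSum.prod_fiberwise fun i => (bilinCLM τ (f i)).hasSum hg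
  have h2 : HasSum (fun i => τ (f i) y) (τ x y) := ((bilinCLM τ).flip y).hasSum hf
  rw [← h1.unique h2]
  exact hS.hasSum

/-- The expansion of a product: the double series is absolutely convergent, and the terms with equal
`p i + q j` are collected. -/
theorem hasExpansion_pairCoeff (h : IsSignedTensor τ β β') (hε : ε 1 = 1) (hε' : ε' 1 = 1)
    (hε1 : εB 1 = 1) (hεB : εB (τ β 1 + τ 1 β') = ε β + ε' β')
    (hN : IsNilpotent (pos ε β)) (hN' : IsNilpotent (pos ε' β')) {p q : ℕ} (hp : 0 < p)
    (hq : 0 < q) {a : ℕ → A} {b : ℕ → A'} {f : ℝ → A} {g : ℝ → A'}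
    (hf : HasExpansion ε p β a f) (hg : HasExpansion ε' q β' b g) :
    HasExpansion εB (Nat.gcd p q) (τ β 1 + τ 1 β') (pairCoeff τ p q a b)
      (fun t => τ (f t) (g t)) := by
  have : CompleteSpace B := FiniteDimensional.complete ℂ B
  intro t ht
  have hgcd : 0 < Nat.gcd p q := Nat.gcd_pos_of_pos_left _ hp
  set γ := τ β 1 + τ 1 β' with hγ
  have hsum := hasSum_bilin τ (hf t ht) (hg t ht)
  have hterm : ∀ ij : ℕ × ℕ, τ (a ij.1 * power ε t (((p * ij.1 : ℕ) : A) + β))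
      (b ij.2 * power ε' t (((q * ij.2 : ℕ) : A') + β')) =
      τ (a ij.1) (b ij.2) * power εB t (((p * ij.1 + q * ij.2 : ℕ) : B) + γ) := by
    intro ij
    rw [power_natCast_add hε ht, power_natCast_add hε' ht, power_natCast_add hε1 ht,
      mul_smul_comm, mul_smul_comm, mul_smul_comm, hγ, h.mul_power hεB hN hN' ht, map_smul,
      map_smul, LinearMap.smul_apply, smul_smul, pow_add, mul_comm]
  simp only [hterm] at hsum
  have hfib := hsum.tsum_fiberwise fun ij => (p * ij.1 + q * ij.2) / Nat.gcd p q
  have hdvd : ∀ ij : ℕ × ℕ, Nat.gcd p q ∣ p * ij.1 + q * ij.2 := fun ij =>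
    dvd_add ((Nat.gcd_dvd_left p q).mul_right _) ((Nat.gcd_dvd_right p q).mul_right _)
  change HasSum (fun m => pairCoeff τ p q a b m *
      power εB t (((Nat.gcd p q * m : ℕ) : B) + γ)) _
  refine HasSum.congr_fun hfib fun m => ?_
  have hset : (fun ij : ℕ × ℕ => (p * ij.1 + q * ij.2) / Nat.gcd p q) ⁻¹' {m} =
      (((Finset.range (Nat.gcd p q * m + 1) ×ˢ Finset.range (Nat.gcd p q * m + 1)).filter
        (fun ij => p * ij.1 + q * ij.2 = Nat.gcd p q * m) : Finset (ℕ × ℕ)) :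
          Set (ℕ × ℕ)) := by
    ext ij
    have h1 := Nat.le_mul_of_pos_left ij.1 hp
    have h2 := Nat.le_mul_of_pos_left ij.2 hq
    simp only [Set.mem_preimage, Set.mem_singleton_iff, Finset.coe_filter, Finset.mem_product,
      Finset.mem_range, Set.mem_ofPred_eq, Nat.div_eq_iff_eq_mul_right hgcd (hdvd ij)]
    exact ⟨fun h => ⟨⟨by omega, by omega⟩, h⟩, fun h => h.2⟩
  rw [pairCoeff, Finset.sum_mul]
  refine Eq.trans ?_ ((tsum_congr_set_coe (fun ij : ℕ × ℕ => τ (a ij.1) (b ij.2) *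
    power εB t (((p * ij.1 + q * ij.2 : ℕ) : B) + γ)) hset).trans
      (Finset.tsum_subtype' _ (fun ij : ℕ × ℕ => τ (a ij.1) (b ij.2) *
        power εB t (((p * ij.1 + q * ij.2 : ℕ) : B) + γ)))).symm
  refine Finset.sum_congr rfl fun ij hij => ?_
  rw [(Finset.mem_filter.1 hij).2]

/-- The normalized coefficients along indices `k` with `k / N → T₁ / T`, after rescaling. -/
theorem tendsto_power_mul_comp (hN : IsNilpotent (pos ε β)) {S : A} {u : ℕ → A}
    (hu : Tendsto u atTop (𝓝 S)) {r : ℕ} (hr : 0 < r) {T₁ T : ℝ} (hT₁ : 0 < T₁) (hT : 0 < T)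
    {ι : Type*} {F : Filter ι} {N k : ι → ℕ} (hNF : Tendsto N F atTop)
    (hk : Tendsto (fun x => (k x : ℝ) / N x) F (𝓝 (T₁ / T))) :
    Tendsto (fun x => power ε (((max (N x) 1 : ℕ) : ℝ) / T * (T₁ / ((max (k x) 1 : ℕ) : ℝ))) β *
      u (k x / r)) F (𝓝 S) := by
  have hpos : 0 < T₁ / T := div_pos hT₁ hT
  have hNR : Tendsto (fun x => (N x : ℝ)) F atTop := tendsto_natCast_atTop_atTop.comp hNF
  have hkR : Tendsto (fun x => (k x : ℝ)) F atTop := by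
    refine (hk.pos_mul_atTop hpos hNR).congr' ?_
    filter_upwards [hNF.eventually_gt_atTop 0] with x hx
    have : (N x : ℝ) ≠ 0 := by exact_mod_cast hx.ne'
    exact div_mul_cancel₀ _ this
  have hkN : Tendsto k F atTop := tendsto_natCast_atTop_iff.1 hkR
  have hs : Tendsto (fun x => ((max (N x) 1 : ℕ) : ℝ) / T * (T₁ / ((max (k x) 1 : ℕ) : ℝ))) F
      (𝓝 1) := by
    have h1 := (tendsto_const_nhds (x := T₁ / T)).div hk hpos.ne'
    rw [div_self hpos.ne'] at h1
    refine h1.congr' ?_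
    filter_upwards [hNF.eventually_gt_atTop 0, hkN.eventually_gt_atTop 0] with x hx hx'
    rw [max_eq_left (Nat.succ_le_of_lt hx), max_eq_left (Nat.succ_le_of_lt hx'), Pi.div_apply]
    field_simp
  have hur : Tendsto (fun x => u (k x / r)) F (𝓝 S) :=
    hu.comp ((Nat.tendsto_div_const_atTop hr.ne').comp hkN)
  simpa using ((tendsto_power_one hN).comp hs).mul hur

/-- A tensor product of coefficients, normalized at `N = n + (N - n)`, is the tensor product of the
rescaled normalized coefficients, weighted by the binomial distribution. -/
theorem normalize_tmul (h : IsSignedTensor τ β β') (hεB : εB (τ β 1 + τ 1 β') = ε β + ε' β')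
    (hN : IsNilpotent (pos ε β)) (hN' : IsNilpotent (pos ε' β')) {T₁ T₂ : ℝ} (hT₁ : 0 < T₁)
    (hT₂ : 0 < T₂) {N n : ℕ} (hn : n ≤ N) (a : A) (b : A') :
    normalize εB (τ β 1 + τ 1 β') (T₁ + T₂) N (τ a b) =
      (binomWeight (T₁ / (T₁ + T₂)) (T₂ / (T₁ + T₂)) N n : ℂ) •
      τ (power ε (((max N 1 : ℕ) : ℝ) / (T₁ + T₂) * (T₁ / ((max n 1 : ℕ) : ℝ))) β *
          normalize ε β T₁ n a)
        (power ε' (((max N 1 : ℕ) : ℝ) / (T₁ + T₂) * (T₂ / ((max (N - n) 1 : ℕ) : ℝ))) β' *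
          normalize ε' β' T₂ (N - n) b) := by
  have hm : ∀ n : ℕ, (0 : ℝ) < ((max n 1 : ℕ) : ℝ) := fun n => by
    exact_mod_cast (by omega : 0 < max n 1)
  have hT : 0 < T₁ + T₂ := add_pos hT₁ hT₂
  have hTc : ((T₁ + T₂ : ℝ) : ℂ) ≠ 0 := by exact_mod_cast hT.ne'
  have hs : 0 < ((max N 1 : ℕ) : ℝ) / (T₁ + T₂) := div_pos (hm N) hT
  have hf : ∀ n : ℕ, (n.factorial : ℂ) ≠ 0 := fun n => by exact_mod_cast n.factorial_ne_zero
  conv_lhs => rw [normalize, h.power_mul hεB hN hN' hs, eq_smul_power_mul_normalize hN hT₁ n a,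
    eq_smul_power_mul_normalize hN' hT₂ (N - n) b]
  rw [mul_smul_comm, mul_smul_comm, ← mul_assoc, ← mul_assoc,
    AML.power_mul hN hs (div_pos hT₁ (hm n)), AML.power_mul hN' hs (div_pos hT₂ (hm _)),
    map_smul, map_smul, LinearMap.smul_apply, smul_smul, smul_smul]
  congr 1
  rw [binomWeight]
  push_cast
  rw [Nat.cast_choose ℂ hn, div_pow, div_pow, ← Nat.add_sub_of_le hn, pow_add,
    Nat.add_sub_cancel_left]
  push_cast at hTc
  have := hf n
  have := hf (N - n)
  field_simp

/-- The normalized coefficients of the product are binomial averages over a lattice of an array that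
converges to `S ⊗ S'` near the mean; the factor `gcd(p, q) / (p q)` is the mass of the lattice. -/
theorem isAML_pairCoeff (h : IsSignedTensor τ β β') (hε : ε 1 = 1) (hε' : ε' 1 = 1)
    (hε1 : εB 1 = 1) (hεB : εB (τ β 1 + τ 1 β') = ε β + ε' β')
    (hN : IsNilpotent (pos ε β)) (hN' : IsNilpotent (pos ε' β')) {p q : ℕ}
    {a : ℕ → A} {b : ℕ → A'} {T₁ T₂ : ℝ} {S : A} {S' : A'}
    (ha : IsAML ε p β a T₁ S) (hb : IsAML ε' q β' b T₂ S') :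
    IsAML εB (Nat.gcd p q) (τ β 1 + τ 1 β') (pairCoeff τ p q a b) (T₁ + T₂)
      (((Nat.gcd p q : ℂ) / ((p : ℂ) * (q : ℂ))) • τ S S') := by
  obtain ⟨hp, hT₁, hu⟩ := (isAML_iff hε hN p a T₁ S).1 ha
  obtain ⟨hq, hT₂, hv⟩ := (isAML_iff hε' hN' q b T₂ S').1 hb
  have hgcd : 0 < Nat.gcd p q := Nat.gcd_pos_of_pos_left _ hp
  have hT : 0 < T₁ + T₂ := add_pos hT₁ hT₂
  refine (isAML_iff hε1 (h.isNilpotent_pos hεB hN hN') _ _ _ _).2 ⟨hgcd, hT, ?_⟩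
  set P := T₁ / (T₁ + T₂) with hP
  set Q := T₂ / (T₁ + T₂) with hQ
  have hP0 : 0 < P := div_pos hT₁ hT
  have hQ0 : 0 < Q := div_pos hT₂ hT
  have hPQ : P + Q = 1 := by rw [hP, hQ, ← add_div, div_self hT.ne']
  set u : ℕ → A := fun i => normalize ε β T₁ (p * i) (a i)
  set v : ℕ → A' := fun j => normalize ε' β' T₂ (q * j) (b j)
  set V : ℕ → ℕ → B := fun N n =>
    τ (power ε (((max N 1 : ℕ) : ℝ) / (T₁ + T₂) * (T₁ / ((max n 1 : ℕ) : ℝ))) β * u (n / p))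
      (power ε' (((max N 1 : ℕ) : ℝ) / (T₁ + T₂) * (T₂ / ((max (N - n) 1 : ℕ) : ℝ))) β' *
        v ((N - n) / q)) with hV
  set s : ℕ → Finset ℕ := fun N => (Finset.range (N + 1)).filter (fun n => p ∣ n ∧ q ∣ N - n)
  have hcoeff : ∀ m, normalize εB (τ β 1 + τ 1 β') (T₁ + T₂) (Nat.gcd p q * m)
      (pairCoeff τ p q a b m) = ∑ n ∈ s (Nat.gcd p q * m),
        (binomWeight P Q (Nat.gcd p q * m) n : ℂ) • V (Nat.gcd p q * m) n := by
    intro m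
    rw [pairCoeff, Finset.sum_filter_mul_add_mul_eq hp hq _ fun i j => τ (a i) (b j), normalize,
      Finset.mul_sum, Finset.smul_sum]
    refine Finset.sum_congr rfl fun n hn => ?_
    obtain ⟨hn1, hn2, hn3⟩ := Finset.mem_filter.1 hn
    have hle : n ≤ Nat.gcd p q * m := Nat.lt_succ_iff.1 (Finset.mem_range.1 hn1)
    have := normalize_tmul h hεB hN hN' hT₁ hT₂ hle (a (n / p)) (b ((Nat.gcd p q * m - n) / q))
    rw [normalize] at this
    rw [this]
    simp only [hV, u, v]
    rw [Nat.mul_div_cancel' hn2, Nat.mul_div_cancel' hn3]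
  simp only [hcoeff]
  have hbound : ∃ (C : ℝ) (κ : ℕ), ∀ N n, n ≤ N → ‖V N n‖ ≤ C * ((N : ℝ) + 1) ^ κ := by
    obtain ⟨C₁, κ₁, hC₁, h₁⟩ := exists_norm_power_mul_le hN hu hT₁
      (le_add_of_nonneg_right hT₂.le)
    obtain ⟨C₂, κ₂, hC₂, h₂⟩ := exists_norm_power_mul_le hN' hv hT₂
      (le_add_of_nonneg_left hT₁.le)
    refine ⟨‖bilinCLM τ‖ * C₁ * C₂, κ₁ + κ₂, fun N n hn => ?_⟩
    calc ‖V N n‖ ≤ ‖bilinCLM τ‖ * _ * _ := (bilinCLM τ).le_opNorm₂ _ _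
      _ ≤ ‖bilinCLM τ‖ * (C₁ * ((N : ℝ) + 1) ^ κ₁) * (C₂ * ((N : ℝ) + 1) ^ κ₂) := by
          gcongr
          · exact h₁ N n _ hn
          · exact h₂ N (N - n) _ (Nat.sub_le _ _)
      _ = _ := by rw [pow_add]; ring
  obtain ⟨C, κ, hbound⟩ := hbound
  have hcomap : Tendsto (fun x : ℕ × ℕ => (x.1, (x.2 : ℝ) / x.1)) (meanFilter P)
      (atTop ×ˢ 𝓝 P) := tendsto_comap
  have hfst : Tendsto (fun x : ℕ × ℕ => x.1) (meanFilter P) atTop :=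
    hcomap.fst
  have hmean : Tendsto (fun x : ℕ × ℕ => (x.2 : ℝ) / x.1) (meanFilter P) (𝓝 P) :=
    hcomap.snd
  have hmean' : Tendsto (fun x : ℕ × ℕ => ((x.1 - x.2 : ℕ) : ℝ) / x.1) (meanFilter P) (𝓝 Q) := by
    have h1 : Tendsto (fun x : ℕ × ℕ => 1 - (x.2 : ℝ) / x.1) (meanFilter P) (𝓝 Q) := by
      rw [show Q = 1 - P by linarith]
      exact hmean.const_sub 1
    refine h1.congr' ?_
    filter_upwards [hfst.eventually_gt_atTop 0, hmean.eventually_lt_const (by linarith : P < 1)]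
      with x hx hx'
    have hx0 : (0 : ℝ) < x.1 := by exact_mod_cast hx
    have hle : x.2 ≤ x.1 := by
      rw [div_lt_one hx0] at hx'
      exact_mod_cast hx'.le
    rw [Nat.cast_sub hle, sub_div, div_self hx0.ne']
  have hlim : Tendsto (fun x : ℕ × ℕ => V x.1 x.2) (meanFilter P) (𝓝 (τ S S')) := by
    have h1 := tendsto_power_mul_comp hN hu hp hT₁ hT hfst hmean
    have h2 := tendsto_power_mul_comp hN' hv hq hT₂ hT hfst hmean'
    have hc : Continuous fun x : A × A' => bilinCLM τ x.1 x.2 :=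
      (bilinCLM τ).isBoundedBilinearMap.continuous
    exact (hc.tendsto (S, S')).comp (h1.prodMk_nhds h2)
  have hmain := (tendsto_sum_binomWeight_smul hP0 hQ0 hPQ hbound hlim s
    fun N => Finset.filter_subset _ _).comp (tendsto_id.const_mul_atTop' hgcd)
  have hmass := (tendsto_sum_binomWeight_lattice hP0 hQ0 hPQ hp hq).smul_const (τ S S')
  have htot := hmain.add hmass
  rw [zero_add] at htot
  refine htot.congr fun m => ?_
  simp only [Function.comp, id, smul_sub, Finset.sum_sub_distrib, Finset.sum_smul]
  exact sub_add_cancel _ _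

end Normed

end AML

/-! ### Passage to the canonical topology -/

namespace AML

/-- The left regular representation is faithful. -/
theorem exists_injective_algHom_endomorphism (A : Type*) [Ring A] [Algebra ℂ A]
    [FiniteDimensional ℂ A] : ∃ (n : ℕ) (φ : A →ₐ[ℂ] ((Fin n → ℂ) →L[ℂ] (Fin n → ℂ))),
      Function.Injective φ := by
  have e : A ≃ₗ[ℂ] (Fin (Module.finrank ℂ A) → ℂ) := (Module.finBasis ℂ A).equivFun
  refine ⟨_, ((Module.End.toContinuousLinearMap _).toAlgHom.comp
    (e.conjAlgEquiv ℂ).toAlgHom).comp (Algebra.lmul ℂ A), ?_⟩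
  exact (Module.End.toContinuousLinearMap _).injective.comp
    ((e.conjAlgEquiv ℂ).injective.comp Algebra.lmul_injective)

theorem topology_eq_moduleTopology (A : Type*) [NormedRing A] [NormedAlgebra ℂ A]
    [FiniteDimensional ℂ A] :
    (UniformSpace.toTopologicalSpace : TopologicalSpace A) = moduleTopology ℂ A := by
  have : IsModuleTopology ℂ A := isModuleTopologyOfFiniteDimensional
  exact eq_moduleTopology ℂ A

/-- The canonical topology of a finite-dimensional algebra is that of the norm induced by a faithful
representation. -/
theorem eq_topology_induced {A : Type*} [Ring A] [Algebra ℂ A] [t : TopologicalSpace A]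
    [IsModuleTopology ℂ A] [FiniteDimensional ℂ A] {n : ℕ}
    (φ : A →ₐ[ℂ] ((Fin n → ℂ) →L[ℂ] (Fin n → ℂ))) (hφ : Function.Injective φ) :
    t = (NormedRing.induced A _ φ hφ).toMetricSpace.toUniformSpace.toTopologicalSpace :=
  (eq_moduleTopology ℂ A).trans (@topology_eq_moduleTopology A (NormedRing.induced A _ φ hφ)
    (NormedAlgebra.induced ℂ A _ φ) ‹_›).symm

/-- The product theorem in finite-dimensional algebras with their canonical topology. -/
theorem hasExpansion_and_isAML_pairCoeff {A A' B : Type*}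
    [Ring A] [Algebra ℂ A] [TopologicalSpace A] [IsModuleTopology ℂ A] [FiniteDimensional ℂ A]
    [Ring A'] [Algebra ℂ A'] [TopologicalSpace A'] [IsModuleTopology ℂ A'] [FiniteDimensional ℂ A']
    [Ring B] [Algebra ℂ B] [TopologicalSpace B] [IsModuleTopology ℂ B] [FiniteDimensional ℂ B]
    {τ : A →ₗ[ℂ] A' →ₗ[ℂ] B} {β : A} {β' : A'}
    {ε : A →ₗ[ℂ] ℂ} {ε' : A' →ₗ[ℂ] ℂ} {εB : B →ₗ[ℂ] ℂ}
    (h : IsSignedTensor τ β β') (hε : ε 1 = 1) (hε' : ε' 1 = 1)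
    (hε1 : εB 1 = 1) (hεB : εB (τ β 1 + τ 1 β') = ε β + ε' β')
    (hN : IsNilpotent (pos ε β)) (hN' : IsNilpotent (pos ε' β')) {p q : ℕ}
    {a : ℕ → A} {b : ℕ → A'} {f : ℝ → A} {g : ℝ → A'} {T₁ T₂ : ℝ} {S : A} {S' : A'}
    (hf : HasExpansion ε p β a f) (hg : HasExpansion ε' q β' b g)
    (ha : IsAML ε p β a T₁ S) (hb : IsAML ε' q β' b T₂ S') :
    HasExpansion εB (Nat.gcd p q) (τ β 1 + τ 1 β') (pairCoeff τ p q a b)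
      (fun t => τ (f t) (g t)) ∧
    IsAML εB (Nat.gcd p q) (τ β 1 + τ 1 β') (pairCoeff τ p q a b) (T₁ + T₂)
      (((Nat.gcd p q : ℂ) / ((p : ℂ) * (q : ℂ))) • τ S S') := by
  obtain ⟨_, φ, hφ⟩ := exists_injective_algHom_endomorphism A
  obtain ⟨_, φ', hφ'⟩ := exists_injective_algHom_endomorphism A'
  obtain ⟨_, ψ, hψ⟩ := exists_injective_algHom_endomorphism B
  let n1 : NormedRing A := NormedRing.induced A _ φ hφ
  let n2 : NormedAlgebra ℂ A := NormedAlgebra.induced ℂ A _ φ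
  let n1' : NormedRing A' := NormedRing.induced A' _ φ' hφ'
  let n2' : NormedAlgebra ℂ A' := NormedAlgebra.induced ℂ A' _ φ'
  let m1 : NormedRing B := NormedRing.induced B _ ψ hψ
  let m2 : NormedAlgebra ℂ B := NormedAlgebra.induced ℂ B _ ψ
  have e1 := eq_topology_induced φ hφ
  have e2 := eq_topology_induced φ' hφ'
  have e3 := eq_topology_induced ψ hψ
  -- from here on the topologies are those of the norms
  subst e1 e2 e3
  exact ⟨hasExpansion_pairCoeff h hε hε' hε1 hεB hN hN' ha.1 hb.1 hf hg,
    isAML_pairCoeff h hε hε' hε1 hεB hN hN' ha hb⟩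

end AML

/-! ### The cohomology rings -/

namespace SingCoh

/-- A singular `0`-cocycle takes equal values on the ends of a path. -/
theorem apply_eq_of_joined {X : Type*} [TopologicalSpace X] {f : Cochain X 0} (hf : f ∈ Z X 0)
    {x y : X} (h : Joined x y) : f (ContinuousMap.const _ x) = f (ContinuousMap.const _ y) := by
  obtain ⟨γ⟩ := h
  let σ : Simplex X 1 :=
    γ.toContinuousMap.comp (stdSimplexHomeomorphUnitInterval : C(stdSimplex ℝ (Fin 2), _))
  have hpull : ∀ i : ℕ, σ.pull (skip 0 i) =
      ContinuousMap.const _ (σ (stdSimplex.vertex (skip 0 i 0))) := by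
    intro i
    ext z
    obtain rfl : z = stdSimplex.vertex (0 : Fin 1) := Subsingleton.elim _ _
    change σ (stdSimplex.map (skip 0 i) (stdSimplex.vertex 0)) = _
    rw [stdSimplex.map_vertex]
    rfl
  have h0 : σ (stdSimplex.vertex (skip 0 0 0)) = y := by
    change γ (stdSimplexHomeomorphUnitInterval ⟨_, single_mem_stdSimplex _ 1⟩) = y
    rw [stdSimplexHomeomorphUnitInterval_one, γ.target]
  have h1 : σ (stdSimplex.vertex (skip 0 1 0)) = x := by
    change γ (stdSimplexHomeomorphUnitInterval ⟨_, single_mem_stdSimplex _ 0⟩) = x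
    rw [stdSimplexHomeomorphUnitInterval_zero, γ.source]
  have hd := congrFun (mem_Z.1 hf) σ
  rw [d_apply, Finset.sum_range_succ, Finset.sum_range_one, hpull, hpull, h0, h1] at hd
  simp only [pow_zero, one_mul, pow_one, neg_mul, Pi.zero_apply] at hd
  exact (add_neg_eq_zero.1 hd).symm

end SingCoh

namespace Cohomology

section

variable {X : Type*} [TopologicalSpace X]

theorem comp_incl_self (n : ℕ) (a : SingCoh.H X n) : comp X n (incl X n a) = a :=
  DirectSum.component.lof_self ℂ n a

theorem comp_incl_of_ne {m n : ℕ} (h : m ≠ n) (a : SingCoh.H X m) : comp X n (incl X m a) = 0 :=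
  (DirectSum.component.of ℂ n m a).trans (dif_neg h)

theorem exists_eq_sum_homogeneous (a : Cohomology X) : ∃ (s : Finset ℕ) (e : ℕ → Cohomology X),
    a = ∑ n ∈ s, e n ∧ ∀ n, e n = incl X n (comp X n a) := by
  classical
  exact ⟨DFinsupp.support (β := SingCoh.H X) a, fun n => incl X n (comp X n a),
    (DirectSum.sum_support_of (β := SingCoh.H X) a).symm, fun _ => rfl⟩

theorem one_eq_incl : (1 : Cohomology X) = incl X 0 (SingCoh.cls (SingCoh.const X 1)) := rfl

theorem evalAt_one (x : X) : evalAt x (1 : Cohomology X) = 1 := by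
  rw [one_eq_incl, evalAt, LinearMap.comp_apply, comp_incl_self]
  rfl

theorem scalar_one [ConnectedSpace X] : scalar X 1 = 1 := evalAt_one _

/-- On a path-connected space the degree zero component of a class is its scalar part. -/
theorem comp_zero_eq [PathConnectedSpace X] (x : X) (a : Cohomology X) :
    comp X 0 a = SingCoh.cls (SingCoh.const X (evalAt x a)) := by
  obtain ⟨f, hf⟩ := SingCoh.cls_surjective (comp X 0 a)
  have hx : evalAt x a = f.1 (ContinuousMap.const _ x) := by
    rw [evalAt, LinearMap.comp_apply, ← hf]
    rfl
  rw [← hf, hx]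
  congr 1
  ext σ
  have hσ : σ = ContinuousMap.const _ (σ (stdSimplex.vertex (0 : Fin 1))) := by
    ext z
    obtain rfl : z = stdSimplex.vertex (0 : Fin 1) := Subsingleton.elim _ _
    rfl
  rw [hσ]
  exact SingCoh.apply_eq_of_joined f.2 (PathConnectedSpace.joined _ _)

theorem comp_zero_pos [ConnectedSpace X] [PathConnectedSpace X] (a : Cohomology X) :
    comp X 0 (AML.pos (scalar X) a) = 0 := by
  have h : algebraMap ℂ (Cohomology X) (scalar X a) =
      incl X 0 (SingCoh.cls (SingCoh.const X (scalar X a))) := rfl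
  rw [AML.pos, map_sub, h, comp_incl_self, comp_zero_eq (Classical.arbitrary X) a, scalar, sub_self]

variable (X) in
/-- The classes whose components of degree less than `k` vanish. -/
noncomputable def degGE (k : ℕ) : Submodule ℂ (Cohomology X) :=
  Submodule.span ℂ {a | ∃ n, k ≤ n ∧ a ∈ deg X n}

theorem mul_mem_degGE {k l : ℕ} {a b : Cohomology X} (ha : a ∈ degGE X k) (hb : b ∈ degGE X l) :
    a * b ∈ degGE X (k + l) := by
  have h : degGE X k * degGE X l ≤ degGE X (k + l) := by
    rw [degGE, degGE, Submodule.span_mul_span, degGE]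
    refine Submodule.span_mono ?_
    rintro _ ⟨x, ⟨m, hm, hx⟩, y, ⟨n, hn, hy⟩, rfl⟩
    exact ⟨m + n, by omega, SetLike.GradedMul.mul_mem hx hy⟩
  exact h (Submodule.mul_mem_mul ha hb)

/-- In finite dimension only finitely many of the independent subspaces `H^n(X)` are nonzero. -/
theorem exists_degGE_eq_bot [FiniteDimensional ℂ (Cohomology X)] : ∃ M, degGE X M = ⊥ := by
  have hfin := WellFoundedGT.finite_ne_bot_of_iSupIndep
    (DirectSum.Decomposition.isInternal (deg X)).submodule_iSupIndep
  obtain ⟨M, hM⟩ := hfin.bddAbove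
  refine ⟨M + 1, Submodule.span_eq_bot.2 ?_⟩
  rintro a ⟨n, hn, ha⟩
  by_contra hne
  have : n ≤ M := hM fun h => hne (by rw [h] at ha; exact ha)
  omega

/-- The `k`-th power of a class of positive degree has components only in degrees at least `k`. -/
theorem isNilpotent_of_comp_zero [FiniteDimensional ℂ (Cohomology X)] {a : Cohomology X}
    (h : comp X 0 a = 0) : IsNilpotent a := by
  have h1 : a ∈ degGE X 1 := by
    obtain ⟨s, e, hs, he⟩ := exists_eq_sum_homogeneous a
    rw [hs]
    refine Submodule.sum_mem _ fun n _ => ?_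
    rw [he]
    rcases Nat.eq_zero_or_pos n with rfl | hn
    · rw [h, map_zero]
      exact Submodule.zero_mem _
    · exact Submodule.subset_span ⟨n, hn, incl_mem X n _⟩
  have h2 : ∀ k, a ^ (k + 1) ∈ degGE X (k + 1) := by
    intro k
    induction k with
    | zero => simpa using h1
    | succ k ih =>
      rw [pow_succ]
      exact mul_mem_degGE ih h1
  obtain ⟨M, hM⟩ := exists_degGE_eq_bot (X := X)
  refine ⟨M + 1, ?_⟩
  rw [pow_succ]
  have h3 : a ^ (M + 1) ∈ degGE X M := by
    refine Submodule.span_mono ?_ (h2 M)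
    rintro x ⟨n, hn, hx⟩
    exact ⟨n, by omega, hx⟩
  rw [hM, Submodule.mem_bot, pow_succ] at h3
  exact h3

theorem isNilpotent_pos [ConnectedSpace X] [PathConnectedSpace X]
    [FiniteDimensional ℂ (Cohomology X)] (a : Cohomology X) :
    IsNilpotent (AML.pos (scalar X) a) :=
  isNilpotent_of_comp_zero (comp_zero_pos a)

theorem isEven_one : IsEven (1 : Cohomology X) := fun n hn => by
  rw [one_eq_incl]
  exact comp_incl_of_ne (by rintro rfl; exact absurd hn (by decide)) _

instance : IsModuleTopology ℂ (Cohomology X) := ⟨rfl⟩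

end

end Cohomology

namespace CohomologyTensor

variable {X Y : Type*} [TopologicalSpace X] [TopologicalSpace Y]

instance : IsModuleTopology ℂ (CohomologyTensor X Y) := ⟨rfl⟩

instance [FiniteDimensional ℂ (Cohomology X)] [FiniteDimensional ℂ (Cohomology Y)] :
    FiniteDimensional ℂ (CohomologyTensor X Y) :=
  Module.Finite.equiv (GradedTensorProduct.of ℂ (Cohomology.deg X) (Cohomology.deg Y))

variable (X Y) in
/-- The tensor product of classes, as a bilinear map. -/
noncomputable def tmulBilin : Cohomology X →ₗ[ℂ] Cohomology Y →ₗ[ℂ] CohomologyTensor X Y :=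
  (TensorProduct.mk ℂ (Cohomology X) (Cohomology Y)).compr₂
    (GradedTensorProduct.of ℂ (Cohomology.deg X) (Cohomology.deg Y)).toLinearMap

theorem tmulBilin_apply (a : Cohomology X) (b : Cohomology Y) : tmulBilin X Y a b = tmul a b := rfl

theorem scalar_tmul [ConnectedSpace X] [ConnectedSpace Y] (a : Cohomology X) (b : Cohomology Y) :
    scalar X Y (tmul a b) = Cohomology.scalar X a * Cohomology.scalar Y b := rfl

theorem tmul_mul_tmul_of_even {i j : ℕ} (h : Even (j * i)) (a : Cohomology X)
    {b : Cohomology Y} (hb : b ∈ Cohomology.deg Y j) {a' : Cohomology X}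
    (ha' : a' ∈ Cohomology.deg X i) (b' : Cohomology Y) :
    tmul a b * tmul a' b' = tmul (a * a') (b * b') := by
  have := GradedTensorProduct.tmul_coe_mul_coe_tmul (R := ℂ) (Cohomology.deg X) (Cohomology.deg Y)
    a ⟨b, hb⟩ ⟨a', ha'⟩ b'
  refine this.trans ?_
  obtain ⟨k, hk⟩ := h
  rw [hk, uzpow_add, Int.units_mul_self, one_smul]
  rfl

/-- The sign in the product of `a ⊗ b` and `a' ⊗ b'` disappears if no component of odd degree of
`b` meets one of `a'`. -/
theorem tmul_mul_tmul {a a' : Cohomology X} {b b' : Cohomology Y}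
    (h : ∀ i j, Odd j → Odd i → Cohomology.comp Y j b = 0 ∨ Cohomology.comp X i a' = 0) :
    tmulBilin X Y a b * tmulBilin X Y a' b' = tmulBilin X Y (a * a') (b * b') := by
  obtain ⟨s, e, hs, he⟩ := Cohomology.exists_eq_sum_homogeneous b
  obtain ⟨s', e', hs', he'⟩ := Cohomology.exists_eq_sum_homogeneous a'
  have key : ∀ j i, tmulBilin X Y a (e j) * tmulBilin X Y (e' i) b' =
      tmulBilin X Y (a * e' i) (e j * b') := by
    intro j i
    rw [he, he']
    by_cases hji : Even (j * i)
    · exact tmul_mul_tmul_of_even hji a (Cohomology.incl_mem Y j _) (Cohomology.incl_mem X i _) b'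
    · rw [Nat.not_even_iff_odd, Nat.odd_mul] at hji
      rcases h i j hji.1 hji.2 with h | h <;> rw [h] <;> simp
  rw [hs, hs']
  simp only [map_sum, LinearMap.sum_apply, Finset.sum_mul, Finset.mul_sum, key]
  exact Finset.sum_comm

theorem isSignedTensor {β : Cohomology X} {β' : Cohomology Y} (hβ : β.IsEven) (hβ' : β'.IsEven) :
    AML.IsSignedTensor (tmulBilin X Y) β β' where
  map_one := rfl
  leftEven_one _ _ _ := tmul_mul_tmul fun i _ _ hi => Or.inr (Cohomology.isEven_one i hi)
  rightEven_one _ _ _ := tmul_mul_tmul fun _ j hj _ => Or.inl (Cohomology.isEven_one j hj)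
  leftEven _ _ _ := tmul_mul_tmul fun i _ _ hi => Or.inr (hβ i hi)
  rightEven _ _ _ := tmul_mul_tmul fun _ j hj _ => Or.inl (hβ' j hj)

end CohomologyTensor

/-! ### The product of two series of cohomology classes -/

theorem mainTheorem3 {dX dY : ℕ}
    (X : Type*) [TopologicalSpace X] [T2Space X] [SecondCountableTopology X] [ConnectedSpace X]
    [ChartedSpace (EuclideanSpace ℝ (Fin dX)) X] [IsManifold (𝓡 dX) ∞ X]
    (Y : Type*) [TopologicalSpace Y] [T2Space Y] [SecondCountableTopology Y] [ConnectedSpace Y]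
    [ChartedSpace (EuclideanSpace ℝ (Fin dY)) Y] [IsManifold (𝓡 dY) ∞ Y]
    [FiniteDimensional ℂ (Cohomology X)] [FiniteDimensional ℂ (Cohomology Y)]
    (rX rY : ℕ) (TX TY : ℝ)
    (βX AX : Cohomology X) (βY AY : Cohomology Y)
    (hβX : βX.IsEven) (hβY : βY.IsEven)
    (aX : ℕ → Cohomology X) (aY : ℕ → Cohomology Y)
    (αX : ℝ → Cohomology X) (αY : ℝ → Cohomology Y)
    (hαX : AML.HasExpansion (Cohomology.scalar X) rX βX aX αX)
    (hαY : AML.HasExpansion (Cohomology.scalar Y) rY βY aY αY)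
    (hX : AML.IsAML (Cohomology.scalar X) rX βX aX TX AX)
    (hY : AML.IsAML (Cohomology.scalar Y) rY βY aY TY AY) :
    AML.HasExpansion (CohomologyTensor.scalar X Y) (Nat.gcd rX rY)
        (CohomologyTensor.tmul βX 1 + CohomologyTensor.tmul 1 βY)
        (AML.prodCoeff rX rY aX aY)
        (fun t => CohomologyTensor.tmul (αX t) (αY t)) ∧
      AML.IsAML (CohomologyTensor.scalar X Y) (Nat.gcd rX rY)
        (CohomologyTensor.tmul βX 1 + CohomologyTensor.tmul 1 βY)
        (AML.prodCoeff rX rY aX aY)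
        (TX + TY)
        (((Nat.gcd rX rY : ℂ) / ((rX : ℂ) * (rY : ℂ))) • CohomologyTensor.tmul AX AY) := by
  have : LocallyPathConnectedSpace X :=
    ChartedSpace.locallyPathConnectedSpace (EuclideanSpace ℝ (Fin dX)) X
  have : LocallyPathConnectedSpace Y :=
    ChartedSpace.locallyPathConnectedSpace (EuclideanSpace ℝ (Fin dY)) Y
  have : PathConnectedSpace X := PathConnectedSpace.of_locallyPathConnectedSpace
  have : PathConnectedSpace Y := PathConnectedSpace.of_locallyPathConnectedSpace
  refine AML.hasExpansion_and_isAML_pairCoeff (τ := CohomologyTensor.tmulBilin X Y)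
    (CohomologyTensor.isSignedTensor hβX hβY) Cohomology.scalar_one Cohomology.scalar_one ?_ ?_
    (Cohomology.isNilpotent_pos βX) (Cohomology.isNilpotent_pos βY) hαX hαY hX hY
  · refine (CohomologyTensor.scalar_tmul (1 : Cohomology X) (1 : Cohomology Y)).trans ?_
    rw [Cohomology.scalar_one, Cohomology.scalar_one, one_mul]
  · rw [map_add, CohomologyTensor.tmulBilin_apply, CohomologyTensor.tmulBilin_apply,
      CohomologyTensor.scalar_tmul, CohomologyTensor.scalar_tmul, Cohomology.scalar_one,
      Cohomology.scalar_one, mul_one, one_mul]
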